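/- Let $(\mathcal E,\times,*)$ be a cartesian closed category with all small colimits, with internal hom $[-,-]$; we also regard $\mathcal E$ as a category enriched over itself. Let $\mathcal P$ be a small coloured symmetric operad enriched in $(\mathcal E,\times,*)$ with set of colours $\mathrm{Ob}(\mathcal P)$: it has objects of operations $\mathcal P(\underline c;c)$ for every tuple of colours $\underline c=(\underline c[1],\dots,\underline c[n])$, $n\ge 0$, and every colour $c$, actions $\sigma^*:\mathcal P(\underline c;c)\to\mathcal P(\underline c^\sigma;c)$ of permutations, where $\underline c^{\sigma}=(\underline c[\sigma(1)],\dots,\underline c[\sigma(n)])$, units $\eta:*\to\mathcal P(c;c)$ and partial compositions $\gamma_i:\mathcal P(\underline c;c)\times\mathcal P(\underline c';\underline c[i])\to\mathcal P(\underline c\triangleleft_i\underline c';c)$, where $\underline c\triangleleft_i\underline c'$ is obtained from $\underline c$ by replacing its $i$-th entry by $\underline c'$. A $\mathcal P$-coalgebra is a family of objects $(V(c))_{c\in\mathrm{Ob}(\mathcal P)}$ of $\mathcal E$ with structure maps $V(c)\times\mathcal P(\underline c;c)\to V(\underline c[1])\times\cdots\times V(\underline c[n])$ compatible with the units, the partial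 compositions and the permutations. For two colours $c,c'$ let $X(c,c')$ be the quotient in $\mathcal E$ of the coproduct of the objects $\mathcal P(\underline c;c)$ over all pairs $(\underline c,i)$ with $1\le i\le|\underline c|$ and $\underline c[i]=c'$ by the following relations: (a) for every permutation $\sigma$, the inclusion of the summand $\mathcal P(\underline c;c)$ indexed by $(\underline c,i)$ is identified with $\sigma^*$ followed by the inclusion of the summand indexed by $(\underline c^\sigma,\sigma^{-1}(i))$; (b) for every $k\ne i$ and every (possibly empty) tuple $\underline c'$, the map on $\mathcal P(\underline c;c)\times\mathcal P(\underline c';\underline c[k])$ given by the first projection followed by the inclusion of the summand indexed by $(\underline c,i)$ is identified with $\gamma_k$ followed by the inclusion of the summand indexed by $(\underline c\triangleleft_k\underline c',i')$, where $i'$ is the position of the $i$-th entry of $\underline c$ in $\underline c\triangleleft_k\underline c'$. Then there exists an $\mathcal E$-enriched category $\mathcal P_{\mathrm{cart}}$ with set of objects $\mathrm{Ob}(\mathcal P)$ which is the quotient, in enriched categories, of the enriched category freely generated by the enriched graph $X$ by the following relations: (c) for all $\underline c,c,i,\underline c',j$, the map $\mathcal P(\underline c;c)\times\mathcal P(\underline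 c';\underline c[i])\to X(c,\underline c[i])\times X(\underline c[i],\underline c'[j])$ given by the positions $i$ and $j$, followed by composition, equals $\gamma_i$ followed by the map $\mathcal P(\underline c\triangleleft_i\underline c';c)\to X(c,\underline c'[j])$ given by the position $i+j-1$; (d) for every $c$, the map $*\xrightarrow{\eta}\mathcal P(c;c)\to X(c,c)$ is the identity of $c$. Moreover there are canonical isomorphisms of categories $$\mathrm{Cog}_{\mathcal E}(\mathcal P)\;\cong\;\mathrm{Cog}_{\mathcal E}(\mathcal P_{\mathrm{cart}}^{\mathrm{op}})\;\cong\;\mathrm{Alg}_{\mathcal E}(\mathcal P_{\mathrm{cart}})$$ commuting with the forgetful functors to $\mathcal E^{\mathrm{Ob}(\mathcal P)}$. Here $\mathcal P_{\mathrm{cart}}^{\mathrm{op}}$ is seen as an enriched operad with only unary operations (the other objects of operations are initial), and $\mathrm{Alg}_{\mathcal E}(\mathcal P_{\mathrm{cart}})$ is the category of enriched functors $\mathcal P_{\mathrm{cart}}\to\mathcal E$ and enriched natural transformations. Canonical means the following. The second isomorphism sends a coalgebra to the enriched functor whose maps $\mathcal P_{\mathrm{cart}}(c,c')\to[V(c),V(c')]$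 are adjoint to the structure maps in arity one. The composite isomorphism sends a $\mathcal P$-coalgebra $V$ to the enriched functor with the same underlying objects for which the composite $\mathcal P(\underline c;c)\to X(c,\underline c[i])\to\mathcal P_{\mathrm{cart}}(c,\underline c[i])\to[V(c),V(\underline c[i])]$ is adjoint to $V(c)\times\mathcal P(\underline c;c)\to V(\underline c[1])\times\cdots\times V(\underline c[n])\to V(\underline c[i])$, for every $\underline c$, $c$ and $i$. -/

import Mathlib

open CategoryTheory MonoidalCategory Limits Opposite

universe w w' v u

noncomputable section

namespace ColouredOperad

/-! ### Tuples of colours -/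

/-- A finite tuple of colours: an object of the groupoid of tuples of elements of `C`. -/
structure ColTuple (C : Type w) where
  /-- the length of the tuple -/
  len : ℕ
  /-- the colours of the tuple -/
  col : Fin len → C

namespace ColTuple

variable {C : Type w}

lemma ext_col {c d : ColTuple C} (h : c.len = d.len)
    (h' : ∀ (p : ℕ) (hp : p < c.len), c.col ⟨p, hp⟩ = d.col ⟨p, h ▸ hp⟩) : c = d := by
  obtain ⟨n, c⟩ := c
  obtain ⟨m, d⟩ := d
  obtain rfl : n = m := h
  congr 1
  funext p
  exact h' p.1 p.2

/-- Morphisms of tuples are bijections of the positions which respect the colours. (They only exist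
between tuples of the same length.) -/
@[ext]
structure Hom (c d : ColTuple C) where
  /-- the underlying bijection -/
  equiv : Fin c.len ≃ Fin d.len
  /-- it respects the colours -/
  col_equiv : ∀ p, d.col (equiv p) = c.col p

instance : Category.{0} (ColTuple C) where
  Hom c d := Hom c d
  id c := ⟨Equiv.refl _, fun _ => rfl⟩
  comp f g := ⟨f.equiv.trans g.equiv, fun p => (g.col_equiv _).trans (f.col_equiv p)⟩

/-- The tuple with a single colour. -/
abbrev single (x : C) : ColTuple C := ⟨1, fun _ => x⟩

/-- The positions of a tuple of length `n` whose `i`-th entry has been replaced by a tuple of length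
`m` are, in order: the positions `< i` of the first tuple, all the positions of the second tuple,
and the positions `> i` of the first tuple. -/
def insertEquiv {n m : ℕ} (i : Fin n) : Fin (n - 1 + m) ≃ {k : Fin n // k ≠ i} ⊕ Fin m where
  toFun p :=
    if h₁ : p.1 < i.1 then .inl ⟨⟨p.1, by omega⟩, fun h => by simp [← h] at h₁⟩
    else if h₂ : p.1 < i.1 + m then .inr ⟨p.1 - i.1, by omega⟩
    else .inl ⟨⟨p.1 - m + 1, by omega⟩, fun h => by simp [← h] at h₁ h₂; omega⟩
  invFun := Sum.elim
    (fun k => if h : k.1.1 < i.1 then ⟨k.1.1, by omega⟩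
      else ⟨k.1.1 - 1 + m, by have := k.1.2; have := fun e => k.2 (Fin.ext e); omega⟩)
    (fun j => ⟨i.1 + j.1, by omega⟩)
  left_inv p := by
    dsimp only
    split_ifs with h₁ h₂
    · simp only [Sum.elim_inl]
      rw [dif_pos h₁]
    · simp only [Sum.elim_inr, Fin.ext_iff]; omega
    · simp only [Sum.elim_inl]
      rw [dif_neg (by omega)]
      simp only [Fin.ext_iff]; omega
  right_inv s := by
    rcases s with ⟨k, hk⟩ | j
    · have hk' : k.1 ≠ i.1 := fun h => hk (Fin.ext h)
      by_cases h : k.1 < i.1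
      · simp only [Sum.elim_inl, dif_pos h]
      · simp only [Sum.elim_inl, dif_neg h]
        rw [dif_neg (by omega), dif_neg (by omega)]
        simp only [Sum.inl.injEq, Subtype.mk.injEq, Fin.ext_iff]; omega
    · simp

/-- `c.insert i c'` is the tuple `c ◁ᵢ c'` obtained from `c` by replacing its `i`-th entry
by the tuple `c'`. -/
def insert (c : ColTuple C) (i : Fin c.len) (c' : ColTuple C) : ColTuple C where
  len := c.len - 1 + c'.len
  col p := Sum.elim (fun k : {k : Fin c.len // k ≠ i} => c.col k.1) c'.col (insertEquiv i p)

/-- The position in `c ◁ᵢ c'` of the position `k ≠ i` of `c`. -/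
def posOuter (c : ColTuple C) (i : Fin c.len) (c' : ColTuple C) (k : Fin c.len) (hk : k ≠ i) :
    Fin (c.insert i c').len :=
  (insertEquiv i).symm (.inl ⟨k, hk⟩)

/-- The position in `c ◁ᵢ c'` of the position `j` of `c'`. -/
def posInner (c : ColTuple C) (i : Fin c.len) (c' : ColTuple C) (j : Fin c'.len) :
    Fin (c.insert i c').len :=
  (insertEquiv i).symm (.inr j)

@[simp]
lemma col_posOuter (c : ColTuple C) (i : Fin c.len) (c' : ColTuple C) (k : Fin c.len)
    (hk : k ≠ i) : (c.insert i c').col (c.posOuter i c' k hk) = c.col k := by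
  simp [insert, posOuter]

@[simp]
lemma col_posInner (c : ColTuple C) (i : Fin c.len) (c' : ColTuple C) (j : Fin c'.len) :
    (c.insert i c').col (c.posInner i c' j) = c'.col j := by
  simp [insert, posInner]

lemma posOuter_val (c : ColTuple C) (i : Fin c.len) (c' : ColTuple C) (k : Fin c.len)
    (hk : k ≠ i) :
    (c.posOuter i c' k hk).1 = if k.1 < i.1 then k.1 else k.1 - 1 + c'.len := by
  simp only [posOuter, insertEquiv, Equiv.coe_fn_symm_mk, Sum.elim_inl]
  split_ifs <;> rfl

lemma posInner_val (c : ColTuple C) (i : Fin c.len) (c' : ColTuple C) (j : Fin c'.len) :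
    (c.posInner i c' j).1 = i.1 + j.1 := rfl

lemma insert_col_lt (c : ColTuple C) (i : Fin c.len) (c' : ColTuple C) (p : ℕ) (hp)
    (h : p < i.1) : (c.insert i c').col ⟨p, hp⟩ = c.col ⟨p, by omega⟩ := by
  simp [insert, insertEquiv, h]

lemma insert_col_mid (c : ColTuple C) (i : Fin c.len) (c' : ColTuple C) (p : ℕ) (hp)
    (h : i.1 ≤ p) (h' : p < i.1 + c'.len) :
    (c.insert i c').col ⟨p, hp⟩ = c'.col ⟨p - i.1, by omega⟩ := by
  simp [insert, insertEquiv, h', Nat.not_lt.2 h]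

lemma insert_col_gt (c : ColTuple C) (i : Fin c.len) (c' : ColTuple C) (p : ℕ) (hp)
    (h : i.1 + c'.len ≤ p) :
    (c.insert i c').col ⟨p, hp⟩ =
      c.col ⟨p - c'.len + 1, by have : p < c.len - 1 + c'.len := hp; omega⟩ := by
  have h₁ : ¬ p < i.1 := by omega
  simp [insert, insertEquiv, h₁, Nat.not_lt.2 h]

lemma insert_single (c : ColTuple C) (i : Fin c.len) {d : C} (h : c.col i = d) :
    c.insert i (single d) = c := by
  have hi := i.2
  have hl : (c.insert i (single d)).len = c.len := by
    change c.len - 1 + 1 = c.len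
    omega
  refine ext_col hl fun p hp => ?_
  rcases lt_trichotomy p i.1 with h₁ | h₁ | h₁
  · rw [insert_col_lt _ _ _ _ _ h₁]
  · rw [insert_col_mid _ _ _ _ _ h₁.ge (by rw [h₁]; exact Nat.lt_succ_self _)]
    subst h₁
    exact h.symm
  · rw [insert_col_gt _ _ _ _ _ h₁]
    congr 1
    ext
    change p - 1 + 1 = p
    omega

lemma single_insert (x : C) (c : ColTuple C) : (single x).insert (0 : Fin 1) c = c := by
  refine ext_col (Nat.zero_add _) fun p hp => ?_
  exact insert_col_mid (single x) (0 : Fin 1) c p hp (Nat.zero_le _)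
    (by have : p < 0 + c.len := hp; simpa using this)

lemma insert_insert_inner (c : ColTuple C) (i : Fin c.len) (c' : ColTuple C) (j : Fin c'.len)
    (c'' : ColTuple C) :
    (c.insert i c').insert (c.posInner i c' j) c'' = c.insert i (c'.insert j c'') := by
  have hi := i.2
  have hj := j.2
  have hl₁ : (c.insert i c').len = c.len - 1 + c'.len := rfl
  have hl₂ : (c'.insert j c'').len = c'.len - 1 + c''.len := rfl
  have hv := c.posInner_val i c' j
  refine ext_col (by
    change c.len - 1 + c'.len - 1 + c''.len = c.len - 1 + (c'.len - 1 + c''.len)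
    omega) fun p hp => ?_
  have hp' : p < c.len - 1 + c'.len - 1 + c''.len := hp
  rcases Nat.lt_or_ge p i.1 with h₁ | h₁
  · rw [insert_col_lt _ _ _ _ _ (by omega), insert_col_lt _ _ _ _ _ h₁,
      insert_col_lt _ _ _ _ _ h₁]
  rcases Nat.lt_or_ge p (i.1 + j.1) with h₂ | h₂
  · rw [insert_col_lt _ _ _ _ _ (by omega), insert_col_mid _ _ _ _ _ h₁ (by omega),
      insert_col_mid _ _ _ _ _ h₁ (by omega), insert_col_lt _ _ _ _ _ (by omega)]
  rcases Nat.lt_or_ge p (i.1 + j.1 + c''.len) with h₃ | h₃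
  · rw [insert_col_mid _ _ _ _ _ (by omega) (by omega),
      insert_col_mid _ _ _ _ _ h₁ (by omega), insert_col_mid _ _ _ _ _ (by omega) (by omega)]
    congr 1
    ext
    change p - (c.posInner i c' j).1 = p - i.1 - j.1
    omega
  rcases Nat.lt_or_ge p (i.1 + (c'.len - 1 + c''.len)) with h₄ | h₄
  · rw [insert_col_gt _ _ _ _ _ (by omega), insert_col_mid _ _ _ _ _ (by omega) (by omega),
      insert_col_mid _ _ _ _ _ h₁ (by omega), insert_col_gt _ _ _ _ _ (by omega)]
    congr 1
    ext
    change p - c''.len + 1 - i.1 = p - i.1 - c''.len + 1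
    omega
  · rw [insert_col_gt _ _ _ _ _ (by omega), insert_col_gt _ _ _ _ _ (by omega),
      insert_col_gt _ _ _ _ _ (by omega)]
    congr 1
    ext
    change p - c''.len + 1 - c'.len + 1 = p - (c'.len - 1 + c''.len) + 1
    omega

lemma insert_insert_outer_of_lt (c : ColTuple C) (i k : Fin c.len) (h : k.1 < i.1)
    (hik : i ≠ k) (c' c'' : ColTuple C) :
    (c.insert i c').insert (c.posOuter i c' k hik.symm) c'' =
      (c.insert k c'').insert (c.posOuter k c'' i hik) c' := by
  have hi := i.2
  have hl₁ : (c.insert i c').len = c.len - 1 + c'.len := rfl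
  have hl₂ : (c.insert k c'').len = c.len - 1 + c''.len := rfl
  have hv₁ := c.posOuter_val i c' k hik.symm
  have hv₂ := c.posOuter_val k c'' i hik
  rw [if_pos h] at hv₁
  rw [if_neg (by omega)] at hv₂
  refine ext_col (by
    change c.len - 1 + c'.len - 1 + c''.len = c.len - 1 + c''.len - 1 + c'.len
    omega) fun p hp => ?_
  have hp' : p < c.len - 1 + c'.len - 1 + c''.len := hp
  rcases Nat.lt_or_ge p k.1 with h₁ | h₁
  · rw [insert_col_lt _ _ _ _ _ (by omega), insert_col_lt _ _ _ _ _ (by omega),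
      insert_col_lt _ _ _ _ _ (by omega), insert_col_lt _ _ _ _ _ (by omega)]
  rcases Nat.lt_or_ge p (k.1 + c''.len) with h₂ | h₂
  · rw [insert_col_mid _ _ _ _ _ (by omega) (by omega), insert_col_lt _ _ _ _ _ (by omega),
      insert_col_mid _ _ _ _ _ (by omega) (by omega)]
    congr 1
    ext
    change p - (c.posOuter i c' k hik.symm).1 = p - k.1
    omega
  rcases Nat.lt_or_ge p (i.1 - 1 + c''.len) with h₃ | h₃
  · rw [insert_col_gt _ _ _ _ _ (by omega), insert_col_lt _ _ _ _ _ (by omega),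
      insert_col_lt _ _ _ _ _ (by omega), insert_col_gt _ _ _ _ _ (by omega)]
  rcases Nat.lt_or_ge p (i.1 - 1 + c''.len + c'.len) with h₄ | h₄
  · rw [insert_col_gt _ _ _ _ _ (by omega), insert_col_mid _ _ _ _ _ (by omega) (by omega),
      insert_col_mid _ _ _ _ _ (by omega) (by omega)]
    congr 1
    ext
    change p - c''.len + 1 - i.1 = p - (c.posOuter k c'' i hik).1
    omega
  · rw [insert_col_gt _ _ _ _ _ (by omega), insert_col_gt _ _ _ _ _ (by omega),
      insert_col_gt _ _ _ _ _ (by omega), insert_col_gt _ _ _ _ _ (by omega)]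
    congr 1
    ext
    change p - c''.len + 1 - c'.len + 1 = p - c'.len + 1 - c''.len + 1
    omega

lemma insert_insert_outer (c : ColTuple C) (i k : Fin c.len) (hik : i ≠ k)
    (c' c'' : ColTuple C) :
    (c.insert i c').insert (c.posOuter i c' k hik.symm) c'' =
      (c.insert k c'').insert (c.posOuter k c'' i hik) c' := by
  rcases Nat.lt_or_ge k.1 i.1 with h | h
  · exact insert_insert_outer_of_lt c i k h hik c' c''
  · have h' : i.1 < k.1 := lt_of_le_of_ne h fun e => hik (Fin.ext e)
    exact (insert_insert_outer_of_lt c k i h' hik.symm c'' c').symm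

/-- The morphism `d ◁ᵢ d' ⟶ c ◁_{f(i)} c'` induced by `f : d ⟶ c` and `g : d' ⟶ c'`. -/
def insertHom {d c d' c' : ColTuple C} (f : d ⟶ c) (i : Fin d.len) (g : d' ⟶ c') :
    d.insert i d' ⟶ c.insert (f.equiv i) c' where
  equiv := (insertEquiv i).trans <|
    (Equiv.sumCongr (f.equiv.subtypeEquiv fun k => by simp) g.equiv).trans
      (insertEquiv (f.equiv i)).symm
  col_equiv p := by
    change Sum.elim _ _ (insertEquiv (f.equiv i) ((insertEquiv (f.equiv i)).symm _)) =
      Sum.elim _ _ (insertEquiv i p)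
    rw [Equiv.apply_symm_apply]
    rcases insertEquiv i p with k | j
    · exact f.col_equiv k.1
    · exact g.col_equiv j

end ColTuple

open ColTuple

/-! ### Enriched operads -/

/-- An operad enriched in `E` with set of colours `C`, presented by partial compositions.
`(seq x).obj (op c)` is the object `P(c; x)`, and a bijection `f : d ⟶ c` of tuples acts by
`(seq x).map f.op : P(c; x) ⟶ P(d; x)`. -/
structure EnrichedOperad (E : Type u) [Category.{v} E] [MonoidalCategory E] [BraidedCategory E]
    (C : Type w) where
  /-- the underlying coloured symmetric sequence -/
  seq : C → (ColTuple C)ᵒᵖ ⥤ E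
  /-- the partial composition `P(c; x) ⊗ P(c'; d) ⟶ P(c ◁ᵢ c'; x)`, where `d` is the `i`-th colour
  of `c` -/
  γ (c : ColTuple C) (i : Fin c.len) (c' : ColTuple C) {d : C} (h : c.col i = d) (x : C) :
    (seq x).obj (op c) ⊗ (seq d).obj (op c') ⟶ (seq x).obj (op (c.insert i c'))
  /-- the units -/
  η (x : C) : 𝟙_ E ⟶ (seq x).obj (op (single x))
  γ_η (c : ColTuple C) (i : Fin c.len) {d : C} (h : c.col i = d) (x : C) :
    (ρ_ _).inv ≫ _ ◁ η d ≫ γ c i (single d) h x =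
      (seq x).map (eqToHom (insert_single c i h)).op
  η_γ (c : ColTuple C) (x : C) :
    (λ_ _).inv ≫ η x ▷ _ ≫ γ (single x) (0 : Fin 1) c rfl x =
      (seq x).map (eqToHom (single_insert x c)).op
  /-- sequential associativity -/
  γ_γ_inner (c : ColTuple C) (i : Fin c.len) (c' : ColTuple C) (j : Fin c'.len)
    (c'' : ColTuple C) {d d' : C} (h : c.col i = d) (h' : c'.col j = d') (x : C) :
    γ c i c' h x ▷ _ ≫
        γ (c.insert i c') (c.posInner i c' j) c'' ((col_posInner c i c' j).trans h') x =
      (α_ _ _ _).hom ≫ _ ◁ γ c' j c'' h' d ≫ γ c i (c'.insert j c'') h x ≫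
        (seq x).map (eqToHom (insert_insert_inner c i c' j c'')).op
  /-- parallel associativity -/
  γ_γ_outer (c : ColTuple C) (i k : Fin c.len) (hik : i ≠ k) (c' c'' : ColTuple C) {d d' : C}
    (h : c.col i = d) (h' : c.col k = d') (x : C) :
    γ c i c' h x ▷ _ ≫
        γ (c.insert i c') (c.posOuter i c' k hik.symm) c''
          ((col_posOuter c i c' k hik.symm).trans h') x =
      (α_ _ _ _).hom ≫ _ ◁ (β_ _ _).hom ≫ (α_ _ _ _).inv ≫ γ c k c'' h' x ▷ _ ≫
        γ (c.insert k c'') (c.posOuter k c'' i hik) c' ((col_posOuter c k c'' i hik).trans h) x ≫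
        (seq x).map (eqToHom (insert_insert_outer c i k hik c' c'')).op
  /-- equivariance -/
  γ_equivariant {a c a' c' : ColTuple C} (f : a ⟶ c) (i : Fin a.len) (g : a' ⟶ c') {d : C}
    (h : a.col i = d) (x : C) :
    γ c (f.equiv i) c' ((f.col_equiv i).trans h) x ≫ (seq x).map (insertHom f i g).op =
      ((seq x).map f.op ⊗ₘ (seq d).map g.op) ≫ γ a i a' h x

/-! ### Coalgebras over an operad in a cartesian closed category -/

section Coalgebras

variable {E : Type u} [Category.{v} E] [CartesianMonoidalCategory E] [BraidedCategory E]
  {C : Type w}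

open CartesianMonoidalCategory

/-- The tensor product `V(c₁) × ⋯ × V(cₙ)` for `c = (c₁, …, cₙ)`. -/
abbrev prodObj (V : C → E) (c : ColTuple C) : E := ∏ᶜ fun p : Fin c.len => V (c.col p)

/-- The components of `prodInsert`. -/
def prodInsertAux (V : C → E) (c : ColTuple C) (i : Fin c.len) (c' : ColTuple C) {d : C}
    (h : c.col i = d) {W : E} (t : V d ⊗ W ⟶ prodObj V c') :
    ∀ s : {k : Fin c.len // k ≠ i} ⊕ Fin c'.len,
      prodObj V c ⊗ W ⟶ V (Sum.elim (fun k : {k : Fin c.len // k ≠ i} => c.col k.1) c'.col s)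
  | .inl k => fst _ _ ≫ Pi.π _ k.1
  | .inr j => (Pi.π _ i ≫ eqToHom (congrArg V h)) ▷ W ≫ t ≫ Pi.π (fun p => V (c'.col p)) j

/-- Given `t : V(cᵢ) × W ⟶ V(c'₁) × ⋯ × V(c'ₘ)`, the map
`(V(c₁) × ⋯ × V(cₙ)) × W ⟶ V(c₁) × ⋯ × (V(c'₁) × ⋯ × V(c'ₘ)) × ⋯ × V(cₙ)`
which applies `t` to the `i`-th factor and to `W`, and is the identity on the other factors. -/
def prodInsert (V : C → E) (c : ColTuple C) (i : Fin c.len) (c' : ColTuple C) {d : C}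
    (h : c.col i = d) {W : E} (t : V d ⊗ W ⟶ prodObj V c') :
    prodObj V c ⊗ W ⟶ prodObj V (c.insert i c') :=
  Pi.lift fun p => prodInsertAux V c i c' h t (insertEquiv i p)

/-- The map `V(c₁) × ⋯ × V(cₙ) ⟶ V(d₁) × ⋯ × V(dₙ)` which permutes the factors along a bijection
`f : d ⟶ c`. -/
def prodPermute (V : C → E) {d c : ColTuple C} (f : d ⟶ c) : prodObj V c ⟶ prodObj V d :=
  Pi.lift fun p => Pi.π (fun q => V (c.col q)) (f.equiv p) ≫ eqToHom (congrArg V (f.col_equiv p))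

/-- A coalgebra over an enriched operad: objects `V(x)` with structure maps
`V(x) × P(c₁, …, cₙ; x) ⟶ V(c₁) × ⋯ × V(cₙ)`. -/
structure OperadCoalgebra (P : EnrichedOperad E C) where
  /-- the underlying objects -/
  obj : C → E
  /-- the structure maps -/
  coact (c : ColTuple C) (x : C) : obj x ⊗ (P.seq x).obj (op c) ⟶ prodObj obj c
  coact_unit (x : C) :
    (ρ_ (obj x)).inv ≫ obj x ◁ P.η x ≫ coact (single x) x ≫
      Pi.π (fun _ : Fin 1 => obj x) 0 = 𝟙 (obj x)
  coact_permute {d c : ColTuple C} (f : d ⟶ c) (x : C) :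
    obj x ◁ (P.seq x).map f.op ≫ coact d x = coact c x ≫ prodPermute obj f
  coact_comp (c : ColTuple C) (i : Fin c.len) (c' : ColTuple C) {d : C} (h : c.col i = d)
    (x : C) :
    obj x ◁ P.γ c i c' h x ≫ coact (c.insert i c') x =
      (α_ _ _ _).inv ≫ coact c x ▷ (P.seq d).obj (op c') ≫
        prodInsert obj c i c' h (coact c' d)

namespace OperadCoalgebra

variable {P : EnrichedOperad E C}

/-- Morphisms of coalgebras. -/
@[ext]
structure Hom (V W : OperadCoalgebra P) where
  /-- the underlying morphisms -/
  app (x : C) : V.obj x ⟶ W.obj x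
  comm (c : ColTuple C) (x : C) :
    V.coact c x ≫ Limits.Pi.map (fun p => app (c.col p)) =
      app x ▷ (P.seq x).obj (op c) ≫ W.coact c x

instance : Category (OperadCoalgebra P) where
  Hom V W := Hom V W
  id V := ⟨fun x => 𝟙 _, fun c x => by simp⟩
  comp f g := ⟨fun x => f.app x ≫ g.app x, fun c x => by
    rw [comp_whiskerRight, Category.assoc, ← g.comm, reassoc_of% (f.comm c x).symm]
    congr 1
    ext p
    simp⟩

variable (P) in
/-- The forgetful functor from coalgebras to families of objects indexed by the colours. -/
def forget : OperadCoalgebra P ⥤ (C → E) where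
  obj V := V.obj
  map f := f.app

end OperadCoalgebra

end Coalgebras

/-! ### Enriched categories as enriched operads -/

section OfCategory

set_option linter.unusedSectionVars false

variable {E : Type u} [Category.{v} E] [CartesianMonoidalCategory E] [BraidedCategory E]
  [MonoidalClosed E] [HasInitial E] {B : Type w} [EnrichedCategory E B]

/-- The operations of an enriched category seen as an operad: the morphism objects in arity one,
and the initial object in the other arities. -/
def unaryObj (c : ColTuple B) (x : B) : E :=
  if h : c.len = 1 then c.col ⟨0, by omega⟩ ⟶[E] x else ⊥_ E

lemma unaryObj_eq (c : ColTuple B) (x : B) (h : c.len = 1) {y : B}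
    (hy : c.col ⟨0, by omega⟩ = y) : (unaryObj c x : E) = (y ⟶[E] x) := by
  subst hy
  exact dif_pos h

lemma unaryObj_eq_initial (c : ColTuple B) (x : B) (h : c.len ≠ 1) :
    (unaryObj c x : E) = ⊥_ E :=
  dif_neg h

/-- In arity one, the operations are the morphisms of the enriched category. -/
def unaryIso (c : ColTuple B) (x : B) (h : c.len = 1) {y : B}
    (hy : c.col ⟨0, by omega⟩ = y) : unaryObj c x ≅ (y ⟶[E] x) :=
  eqToIso (unaryObj_eq c x h hy)

/-- In other arities, the operations form an initial object. -/
def unaryInitial (c : ColTuple B) (x : B) (h : c.len ≠ 1) : IsInitial (unaryObj c x : E) :=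
  IsInitial.ofIso initialIsInitial (eqToIso (unaryObj_eq_initial c x h).symm)

lemma unaryObj_hom {d c : ColTuple B} (f : d ⟶ c) (x : B) :
    (unaryObj c x : E) = unaryObj d x := by
  have hl : d.len = c.len := by simpa using Fintype.card_congr f.equiv
  by_cases h : c.len = 1
  · rw [unaryObj_eq c x h rfl]
    refine (unaryObj_eq d x (hl.trans h) ?_).symm
    rw [← f.col_equiv]
    congr 1
    ext
    have := (f.equiv ⟨0, by omega⟩).2
    dsimp only
    omega
  · exact (unaryObj_eq_initial c x h).trans (unaryObj_eq_initial d x (by omega)).symm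

lemma unaryObj_ext_left {c : ColTuple B} {x : B} {W Z : E} (f g : unaryObj c x ⊗ W ⟶ Z)
    (h : c.len ≠ 1) : f = g :=
  (IsInitial.ofIso (unaryInitial c x h) (mulZero (unaryInitial c x h)).symm).hom_ext f g

lemma unaryObj_ext_right {c : ColTuple B} {x : B} {W Z : E} (f g : W ⊗ unaryObj c x ⟶ Z)
    (h : c.len ≠ 1) : f = g :=
  (IsInitial.ofIso (unaryInitial c x h) (zeroMul (unaryInitial c x h)).symm).hom_ext f g

lemma insert_len_eq_one {c c' : ColTuple B} {i : Fin c.len} (hc : c.len = 1) (hc' : c'.len = 1) :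
    (c.insert i c').len = 1 := by
  change c.len - 1 + c'.len = 1
  omega

lemma insert_col_zero {c c' : ColTuple B} {i : Fin c.len} (hc : c.len = 1) (hc' : c'.len = 1) :
    (c.insert i c').col ⟨0, by rw [insert_len_eq_one hc hc']; omega⟩ =
      c'.col ⟨0, by omega⟩ := by
  have hi : i.1 = 0 := by omega
  rw [insert_col_mid _ _ _ _ _ (by omega) (by omega)]
  congr 1
  ext
  simp

/-- The partial composition of the operad associated with an enriched category. -/
def unaryComp (c : ColTuple B) (i : Fin c.len) (c' : ColTuple B) {d : B} (h : c.col i = d)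
    (x : B) : unaryObj c x ⊗ unaryObj c' d ⟶ (unaryObj (c.insert i c') x : E) :=
  if hc : c.len = 1 then
    if hc' : c'.len = 1 then
      ((unaryIso c x hc (by rw [← h]; congr 1; ext; dsimp only; omega)).hom ⊗ₘ
          (unaryIso c' d hc' rfl).hom) ≫ (β_ (d ⟶[E] x) _).hom ≫ eComp E _ d x ≫
        (unaryIso _ x (insert_len_eq_one hc hc') (insert_col_zero hc hc')).inv
    else (IsInitial.ofIso (unaryInitial c' d hc') (zeroMul (unaryInitial c' d hc')).symm).to _
  else (IsInitial.ofIso (unaryInitial c x hc) (mulZero (unaryInitial c x hc)).symm).to _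

lemma unaryComp_eq (c : ColTuple B) (i : Fin c.len) (c' : ColTuple B) {d : B} (h : c.col i = d)
    (x : B) (hc : c.len = 1) (hc' : c'.len = 1) {y : B} (hy : c'.col ⟨0, by omega⟩ = y)
    (hd : c.col ⟨0, by omega⟩ = d) :
    (unaryComp c i c' h x : _ ⟶ (_ : E)) =
      ((unaryIso c x hc hd).hom ⊗ₘ (unaryIso c' d hc' hy).hom) ≫ (β_ (d ⟶[E] x) _).hom ≫
        eComp E _ d x ≫
        (unaryIso _ x (insert_len_eq_one hc hc') ((insert_col_zero hc hc').trans hy)).inv := by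
  subst hy
  rw [unaryComp, dif_pos hc, dif_pos hc']

lemma unary_unit_right {d x : B} {X U : E} (e : X ≅ (d ⟶[E] x)) (k : U ≅ (d ⟶[E] d)) :
    (ρ_ X).inv ≫ X ◁ (eId E d ≫ k.inv) ≫ (e.hom ⊗ₘ k.hom) ≫ (β_ _ _).hom ≫ eComp E d d x =
      e.hom := by
  have : X ◁ (eId E d ≫ k.inv) ≫ (e.hom ⊗ₘ k.hom) = e.hom ⊗ₘ eId E d := by
    simp [← id_tensorHom, tensorHom_comp_tensorHom]
  rw [reassoc_of% this, BraidedCategory.braiding_naturality_assoc,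
    MonoidalCategory.tensorHom_def', Category.assoc]
  rw [← BraidedCategory.braiding_naturality_left_assoc, ← rightUnitor_inv_naturality_assoc]
  simp only [braiding_tensorUnit_right, Category.assoc,
    e_id_comp, Iso.inv_hom_id, Category.comp_id]

lemma unary_unit_left {y x : B} {X U : E} (e : X ≅ (y ⟶[E] x)) (k : U ≅ (x ⟶[E] x)) :
    (λ_ X).inv ≫ (eId E x ≫ k.inv) ▷ X ≫ (k.hom ⊗ₘ e.hom) ≫ (β_ _ _).hom ≫ eComp E y x x =
      e.hom := by
  have : (eId E x ≫ k.inv) ▷ X ≫ (k.hom ⊗ₘ e.hom) = eId E x ⊗ₘ e.hom := by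
    simp [← tensorHom_id, tensorHom_comp_tensorHom]
  rw [reassoc_of% this, BraidedCategory.braiding_naturality_assoc,
    MonoidalCategory.tensorHom_def, Category.assoc]
  rw [← BraidedCategory.braiding_naturality_right_assoc, ← leftUnitor_inv_naturality_assoc]
  simp only [braiding_tensorUnit_left, Category.assoc,
    e_comp_id, Iso.inv_hom_id, Category.comp_id]

lemma unary_assoc {x d d' y : B} {X Y Z W W' : E} (e : X ≅ (d ⟶[E] x)) (f : Y ≅ (d' ⟶[E] d))
    (g : Z ≅ (y ⟶[E] d')) (k : W ≅ (d' ⟶[E] x)) (k' : W' ≅ (y ⟶[E] d)) :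
    ((e.hom ⊗ₘ f.hom) ≫ (β_ _ _).hom ≫ eComp E d' d x ≫ k.inv) ▷ Z ≫
        (k.hom ⊗ₘ g.hom) ≫ (β_ _ _).hom ≫ eComp E y d' x =
      (α_ X Y Z).hom ≫ X ◁ ((f.hom ⊗ₘ g.hom) ≫ (β_ _ _).hom ≫ eComp E y d' d ≫ k'.inv) ≫
        (e.hom ⊗ₘ k'.hom) ≫ (β_ _ _).hom ≫ eComp E y d x := by
  have h₁ : ((e.hom ⊗ₘ f.hom) ≫ (β_ _ _).hom ≫ eComp E d' d x ≫ k.inv) ▷ Z ≫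
      (k.hom ⊗ₘ g.hom) = ((e.hom ⊗ₘ f.hom) ⊗ₘ g.hom) ≫
        ((β_ _ _).hom ≫ eComp E d' d x) ▷ _ := by
    simp only [← tensorHom_id, tensorHom_comp_tensorHom]
    simp
  have h₂ : X ◁ ((f.hom ⊗ₘ g.hom) ≫ (β_ _ _).hom ≫ eComp E y d' d ≫ k'.inv) ≫
        (e.hom ⊗ₘ k'.hom) = (e.hom ⊗ₘ (f.hom ⊗ₘ g.hom)) ≫
          _ ◁ ((β_ _ _).hom ≫ eComp E y d' d) := by
    simp [← id_tensorHom, tensorHom_comp_tensorHom]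
  rw [reassoc_of% h₁, reassoc_of% h₂, ← MonoidalCategory.associator_naturality_assoc]
  congr 1
  rw [BraidedCategory.braiding_naturality_left_assoc,
    BraidedCategory.braiding_naturality_right_assoc]
  simp only [MonoidalCategory.whiskerLeft_comp, comp_whiskerRight, Category.assoc]
  rw [← e_assoc]
  simp only [BraidedCategory.braiding_tensor_left_hom, BraidedCategory.braiding_tensor_right_hom,
    Category.assoc]
  simp only [← Category.assoc]
  congr 2
  ext <;> simp

lemma unaryIso_inv_eqToHom (c c' : ColTuple B) (x : B) (h : c.len = 1) (h' : c'.len = 1) {y : B}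
    (hy : c.col ⟨0, by omega⟩ = y) (hy' : c'.col ⟨0, by omega⟩ = y)
    (e : (unaryObj c x : E) = unaryObj c' x) :
    (unaryIso c x h hy).inv ≫ eqToHom e = ((unaryIso c' x h' hy').inv : _ ⟶ (_ : E)) := by
  simp [unaryIso]

variable (E B) in
/-- An enriched category seen as an enriched operad, with only unary operations. -/
def EnrichedOperad.ofCategory : EnrichedOperad E B where
  seq x :=
    { obj c := unaryObj c.unop x
      map f := eqToHom (unaryObj_hom f.unop x)
      map_id _ := rfl
      map_comp _ _ := by simp }
  γ c i c' _ h x := unaryComp c i c' h x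
  η x := eId E x ≫ (unaryIso (single x) x rfl rfl).inv
  γ_η c i d h x := by
    by_cases hc : c.len = 1
    · have hd : c.col ⟨0, by omega⟩ = d := by
        rw [← h]; congr 1; ext; dsimp only; omega
      change _ = eqToHom (unaryObj_hom (eqToHom (insert_single c i h)) x)
      rw [unaryComp_eq c i (single d) h x hc rfl rfl hd]
      rw [← unaryIso_inv_eqToHom c _ x hc (insert_len_eq_one hc rfl) hd
        ((insert_col_zero hc rfl).trans rfl) (unaryObj_hom (eqToHom (insert_single c i h)) x)]
      have := unary_unit_right (E := E) (unaryIso c x hc hd) (unaryIso (single d) d rfl rfl)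
      have h' := (reassoc_of% this) ((unaryIso c x hc hd).inv ≫
        eqToHom (unaryObj_hom (eqToHom (insert_single c i h)) x))
      rw [Iso.hom_inv_id_assoc] at h'
      exact h'
    · exact (unaryInitial c x hc).hom_ext _ _
  η_γ c x := by
    by_cases hc : c.len = 1
    · change _ = eqToHom (unaryObj_hom (eqToHom (single_insert x c)) x)
      rw [unaryComp_eq (single x) (0 : Fin 1) c rfl x rfl hc rfl rfl]
      rw [← unaryIso_inv_eqToHom c _ x hc (insert_len_eq_one rfl hc) rfl
        (insert_col_zero rfl hc) (unaryObj_hom (eqToHom (single_insert x c)) x)]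
      have := unary_unit_left (E := E) (unaryIso c x hc rfl) (unaryIso (single x) x rfl rfl)
      have h' := (reassoc_of% this) ((unaryIso c x hc rfl).inv ≫
        eqToHom (unaryObj_hom (eqToHom (single_insert x c)) x))
      rw [Iso.hom_inv_id_assoc] at h'
      exact h'
    · exact (unaryInitial c x hc).hom_ext _ _
  γ_γ_inner c i c' j c'' d d' h h' x := by
    by_cases hc : c.len = 1
    · by_cases hc' : c'.len = 1
      · by_cases hc'' : c''.len = 1
        · have hd : c.col ⟨0, by omega⟩ = d := by
            rw [← h]; congr 1; ext; dsimp only; omega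
          have hd' : c'.col ⟨0, by omega⟩ = d' := by
            rw [← h']; congr 1; ext; dsimp only; omega
          change _ = (α_ _ _ _).hom ≫ _ ◁ _ ≫ _ ≫
            eqToHom (unaryObj_hom (eqToHom (insert_insert_inner c i c' j c'')) x)
          rw [unaryComp_eq c i c' h x hc hc' hd' hd,
            unaryComp_eq c' j c'' h' d hc' hc'' rfl hd',
            unaryComp_eq (c.insert i c') _ c'' _ x (insert_len_eq_one hc hc') hc'' rfl
              ((insert_col_zero hc hc').trans hd'),
            unaryComp_eq c i (c'.insert j c'') h x hc (insert_len_eq_one hc' hc'')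
              (insert_col_zero hc' hc'') hd]
          simp only [Category.assoc]
          rw [unaryIso_inv_eqToHom (h' := insert_len_eq_one (insert_len_eq_one hc hc') hc'')
            (hy' := insert_col_zero (insert_len_eq_one hc hc') hc'')]
          have := unary_assoc (E := E) (unaryIso c x hc hd) (unaryIso c' d hc' hd')
            (unaryIso c'' d' hc'' rfl)
            (unaryIso (c.insert i c') x (insert_len_eq_one hc hc')
              ((insert_col_zero hc hc').trans hd'))
            (unaryIso (c'.insert j c'') d (insert_len_eq_one hc' hc'')
              (insert_col_zero hc' hc''))
          have h₁ := (reassoc_of% this) ((unaryIso (c.insert i (c'.insert j c'')) x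
            (insert_len_eq_one hc (insert_len_eq_one hc' hc''))
            ((insert_col_zero hc (insert_len_eq_one hc' hc'')).trans
              (insert_col_zero hc' hc''))).inv ≫
            eqToHom (unaryObj_hom (eqToHom (insert_insert_inner c i c' j c'')) x))
          rw [unaryIso_inv_eqToHom (h' := insert_len_eq_one (insert_len_eq_one hc hc') hc'')
            (hy' := insert_col_zero (insert_len_eq_one hc hc') hc'')] at h₁
          exact h₁
        · exact unaryObj_ext_right _ _ hc''
      · exact (IsInitial.ofIso (unaryInitial c' d hc') ((zeroMul (unaryInitial c' d hc')).symm ≪≫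
          (mulZero (IsInitial.ofIso (unaryInitial c' d hc')
            (zeroMul (unaryInitial c' d hc')).symm)).symm)).hom_ext _ _
    · rw [← cancel_epi (α_ _ _ _).inv]
      exact unaryObj_ext_left _ _ hc
  γ_γ_outer c i k hik c' c'' d d' h h' x := by
    have hc : c.len ≠ 1 := fun e => hik (by ext; omega)
    rw [← cancel_epi (α_ _ _ _).inv]
    exact unaryObj_ext_left _ _ hc
  γ_equivariant {a c a' c'} f i g d h x := by
    by_cases hc : c.len = 1
    · by_cases hc' : c'.len = 1
      · have hl : a.len = c.len := by simpa using Fintype.card_congr f.equiv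
        have hl' : a'.len = c'.len := by simpa using Fintype.card_congr g.equiv
        have hd : a.col ⟨0, by omega⟩ = d := by
          rw [← h]; congr 1; ext; dsimp only; omega
        have hd' : c.col ⟨0, by omega⟩ = d := by
          rw [← h, ← f.col_equiv]; congr 1; ext; dsimp only; omega
        have hy : a'.col ⟨0, by omega⟩ = c'.col ⟨0, by omega⟩ := by
          rw [← g.col_equiv]; congr 1; ext; dsimp only; omega
        change _ ≫ eqToHom (unaryObj_hom (insertHom f i g) x) =
          (eqToHom (unaryObj_hom f x) ⊗ₘ eqToHom (unaryObj_hom g d)) ≫ _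
        rw [unaryComp_eq c (f.equiv i) c' _ x hc hc' rfl hd',
          unaryComp_eq a i a' h x (hl.trans hc) (hl'.trans hc') hy hd]
        simp only [Category.assoc]
        rw [unaryIso_inv_eqToHom (h' := insert_len_eq_one (hl.trans hc) (hl'.trans hc'))
          (hy' := (insert_col_zero (hl.trans hc) (hl'.trans hc')).trans hy),
          tensorHom_comp_tensorHom_assoc]
        simp [unaryIso]
      · exact unaryObj_ext_right _ _ hc'
    · exact unaryObj_ext_left _ _ hc

end OfCategory

/-! ### Algebras over an enriched category -/

section Algebra

open MonoidalClosed

/-- An algebra in `E` over an enriched category `A`: an enriched functor from `A` to `E`, where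
`E` is enriched over itself by its internal hom objects. -/
structure CatAlgebra (E : Type u) [Category.{v} E] [MonoidalCategory E] [MonoidalClosed E]
    (A : Type w) [EnrichedCategory E A] where
  /-- the underlying enriched functor -/
  toFunctor : EnrichedFunctor E A E

namespace CatAlgebra

variable {E : Type u} [Category.{v} E] [MonoidalCategory E] [MonoidalClosed E]
  {A : Type w} [EnrichedCategory E A]

/-- Morphisms of algebras are enriched natural transformations: the two maps
`A(x, y) ⟶ [F x, G y]` induced by the components are required to be equal. -/
@[ext]
structure Hom (F G : CatAlgebra E A) where
  /-- the components -/
  app (x : A) : F.toFunctor.obj x ⟶ G.toFunctor.obj x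
  naturality (x y : A) :
    F.toFunctor.map x y ≫ (ihom (F.toFunctor.obj x)).map (app y) =
      G.toFunctor.map x y ≫ (pre (app x)).app (G.toFunctor.obj y)

instance : Category (CatAlgebra E A) where
  Hom F G := Hom F G
  id F := ⟨fun x => 𝟙 _, fun x y => by simp⟩
  comp {F G H} f g := ⟨fun x => f.app x ≫ g.app x, fun x y => by
    have h₁ := f.naturality x y
    have h₂ := g.naturality x y
    rw [Functor.map_comp, reassoc_of% h₁, pre_map, NatTrans.comp_app,
      ← reassoc_of% h₂, (pre (f.app x)).naturality]⟩

variable (E A) in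
/-- The forgetful functor to families of objects indexed by the objects of `A`. -/
def forget : CatAlgebra E A ⥤ (A → E) where
  obj F := F.toFunctor.obj
  map f := f.app

end CatAlgebra

end Algebra

/-! ### Graphs enriched in `E` -/

/-- A morphism from an enriched graph `X` to the graph underlying an enriched category `B`. -/
@[ext]
structure GraphHom {E : Type u} [Category.{v} E] [MonoidalCategory E] {C : Type w}
    (X : C → C → E) (B : Type w') [EnrichedCategory E B] where
  /-- the map on objects -/
  obj : C → B
  /-- the maps on morphism objects -/
  map (x y : C) : X x y ⟶ (obj x ⟶[E] obj y)

namespace GraphHom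

variable {E : Type u} [Category.{v} E] [MonoidalCategory E] {C : Type w} {X Y : C → C → E}
  {B : Type w'} [EnrichedCategory E B]

/-- Postcomposition with an enriched functor. -/
def comp {B' : Type*} [EnrichedCategory E B'] (φ : GraphHom X B) (F : EnrichedFunctor E B B') :
    GraphHom X B' where
  obj x := F.obj (φ.obj x)
  map x y := φ.map x y ≫ F.map _ _

/-- Precomposition with a morphism of graphs which is the identity on objects. -/
def precomp (α : ∀ x y, X x y ⟶ Y x y) (φ : GraphHom Y B) : GraphHom X B where
  obj := φ.obj
  map x y := α x y ≫ φ.map x y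

/-- A graph morphism to an enriched category with the same objects, identity on objects. -/
def ofId {X : B → B → E} (ι : ∀ x y, X x y ⟶ (x ⟶[E] y)) : GraphHom X B where
  obj x := x
  map := ι

/-- The graph morphism underlying an enriched functor. -/
def ofFunctor {B' : Type*} [EnrichedCategory E B'] (F : EnrichedFunctor E B B') :
    GraphHom (fun x y : B => (x ⟶[E] y)) B' where
  obj := F.obj
  map := F.map

end GraphHom

/-! ### The presentation of the enriched category `P_cart` -/

section Presentation

open CartesianMonoidalCategory MonoidalClosed

variable {E : Type u} [Category.{v} E] [CartesianMonoidalCategory E] [BraidedCategory E]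
  [HasColimits E] {C : Type v} (P : EnrichedOperad E C)

/-- The coproduct of the objects `P(c; x)` over all tuples `c` with a marked position of
colour `y`. -/
def rawGenerators (x y : C) : E :=
  ∐ fun s : (c : ColTuple C) × {i : Fin c.len // c.col i = y} => (P.seq x).obj (op s.1)

/-- The summand of the tuple `c` with marked position `i`. -/
def rawIncl (c : ColTuple C) (i : Fin c.len) {y : C} (h : c.col i = y) (x : C) :
    (P.seq x).obj (op c) ⟶ rawGenerators P x y :=
  Sigma.ι (fun s : (c : ColTuple C) × {i : Fin c.len // c.col i = y} => (P.seq x).obj (op s.1))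
    ⟨c, i, h⟩

/-- The indices of the relations coming from permutations. -/
structure PermRel (y : C) where
  /-- the permuted tuple -/
  dom : ColTuple C
  /-- the tuple -/
  cod : ColTuple C
  /-- the permutation -/
  f : dom ⟶ cod
  /-- the marked position -/
  i : Fin dom.len
  /-- its colour -/
  col_i : dom.col i = y

/-- The indices of the relations coming from partial compositions away from the marked position. -/
structure OuterRel (y : C) where
  /-- the first tuple -/
  c : ColTuple C
  /-- the marked position -/
  i : Fin c.len
  /-- its colour -/
  col_i : c.col i = y
  /-- the position of the partial composition -/
  k : Fin c.len
  /-- it differs from the marked position -/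
  ne : i ≠ k
  /-- the second tuple -/
  c' : ColTuple C

/-- The sources of the relations between generators. -/
def relObj (x y : C) : PermRel y ⊕ OuterRel y → E
  | .inl r => (P.seq x).obj (op r.cod)
  | .inr r => (P.seq x).obj (op r.c) ⊗ (P.seq (r.c.col r.k)).obj (op r.c')

/-- The first map defining the relations between generators. -/
def relLeft (x y : C) : ∀ r : PermRel y ⊕ OuterRel y, relObj P x y r ⟶ rawGenerators P x y
  | .inl r => rawIncl P r.cod (r.f.equiv r.i) ((r.f.col_equiv r.i).trans r.col_i) x
  | .inr r => fst _ _ ≫ rawIncl P r.c r.i r.col_i x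

/-- The second map defining the relations between generators. -/
def relRight (x y : C) : ∀ r : PermRel y ⊕ OuterRel y, relObj P x y r ⟶ rawGenerators P x y
  | .inl r => (P.seq x).map r.f.op ≫ rawIncl P r.dom r.i r.col_i x
  | .inr r => P.γ r.c r.k r.c' rfl x ≫
      rawIncl P (r.c.insert r.k r.c') (r.c.posOuter r.k r.c' r.i r.ne)
        ((col_posOuter _ _ _ _ _).trans r.col_i) x

/-- The graph `X` of generators of `P_cart`: `X(x, y)` is the quotient of the coproduct of the
`P(c; x)`, over all tuples `c` with a marked position of colour `y`, by the relations which
identify an operation with its permutations and with its partial compositions at the positions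
which are not marked. -/
def generators (x y : C) : E :=
  coequalizer (Sigma.desc (relLeft P x y)) (Sigma.desc (relRight P x y))

/-- The quotient map. -/
def generatorsπ (x y : C) : rawGenerators P x y ⟶ generators P x y :=
  coequalizer.π _ _

/-- The map from `P(c; x)` to the generators given by the position `i` of `c`. -/
def incl (c : ColTuple C) (i : Fin c.len) {y : C} (h : c.col i = y) (x : C) :
    (P.seq x).obj (op c) ⟶ generators P x y :=
  rawIncl P c i h x ≫ generatorsπ P x y

variable {P} in
/-- The relations of the presentation of `P_cart`, for a morphism from the graph of generators to
an enriched category. -/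
structure SatisfiesRelations {B : Type w} [EnrichedCategory E B]
    (φ : GraphHom (generators P) B) : Prop where
  comp (c : ColTuple C) (i : Fin c.len) (c' : ColTuple C) (j : Fin c'.len) {d y : C}
    (h : c.col i = d) (h' : c'.col j = y) (x : C) :
    P.γ c i c' h x ≫
        incl P (c.insert i c') (c.posInner i c' j) ((col_posInner c i c' j).trans h') x ≫
          φ.map x y =
      (incl P c i h x ⊗ₘ incl P c' j h' d) ≫ (φ.map x d ⊗ₘ φ.map d y) ≫
        eComp E (φ.obj x) (φ.obj d) (φ.obj y)
  unit (x : C) :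
    P.η x ≫ incl P (single x) (0 : Fin 1) rfl x ≫ φ.map x x = eId E (φ.obj x)

variable {P} in
/-- The enriched category structure on the set of colours `C`, with the graph morphism `ι`, is the
quotient of the free enriched category on the graph of generators by the relations: enriched
functors from it to an enriched category `B` correspond bijectively to morphisms from the graph of
generators to `B` which satisfy the relations. -/
structure IsCartPresentation [EnrichedCategory E C]
    (ι : ∀ x y : C, generators P x y ⟶ (x ⟶[E] y)) : Prop where
  relations : SatisfiesRelations (GraphHom.ofId ι)
  universal (B : Type w) [EnrichedCategory E B] (φ : GraphHom (generators P) B) :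
    SatisfiesRelations φ → ∃! F : EnrichedFunctor E C B, (GraphHom.ofId ι).comp F = φ

variable [MonoidalClosed E]

variable {P} in
/-- The action of the operations on a coalgebra: the map `P(c; x) ⟶ [V(x), V(y)]` attached to a
position `i` of `c` of colour `y` is adjoint to
`V(x) × P(c; x) ⟶ V(c₁) × ⋯ × V(cₙ) ⟶ V(cᵢ)`. -/
def OperadCoalgebra.rawAction (V : OperadCoalgebra P) : GraphHom (rawGenerators P) E where
  obj := V.obj
  map x _ := Sigma.desc fun s => curry <|
    V.coact s.1 x ≫ Pi.π (fun p => V.obj (s.1.col p)) s.2.1 ≫ eqToHom (congrArg V.obj s.2.2)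

/-- The action of `A` on a coalgebra over the opposite of the enriched category `A`: the map
`A(x, y) ⟶ [V(x), V(y)]` is adjoint to the structure map of the coalgebra in arity one. -/
def OperadCoalgebra.opAction {A : Type w} [EnrichedCategory E A]
    (V : OperadCoalgebra (EnrichedOperad.ofCategory E Aᵒᵖ)) :
    GraphHom (fun x y : A => (x ⟶[E] y)) E where
  obj x := V.obj (op x)
  map x y := curry <|
    V.obj (op x) ◁ (unaryIso (single (op y)) (op x) rfl rfl).inv ≫
      V.coact (single (op y)) (op x) ≫ Pi.π (fun _ : Fin 1 => V.obj (op y)) 0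

end Presentation

end ColouredOperad

end

open ColouredOperad MonoidalClosed

noncomputable section

namespace ColouredOperad

open ColTuple CartesianMonoidalCategory

/-! Because the tensor product is the cartesian product, a structure map `V x ⊗ P(c; x) ⟶ ∏ V(cᵢ)`
is the same as its components `V x ⊗ P(c; x) ⟶ V(cᵢ)`, one for each marked position `i`, and the
coalgebra axioms can be tested on components. Compatibility with a partial composition then splits
in two. At a position untouched by the composition it says that the second operation is discarded
(`coactAt_outer`). At a position of the inserted tuple it says that the two components are composed
(`coactAt_inner`). Under the adjunction with the internal hom, compatibility with permutations and
the first case say exactly that the components factor through the graph of generators, while the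
second case and the unit axiom are relations (c) and (d).

The free enriched category never has to be built, because the generators already form an enriched
category. The composite of two marked operations is again a marked operation (`compIncl`). This rule
descends to the quotients by equivariance (`compIncl_permute`), sequential associativity
(`compIncl_outer_right`) and parallel associativity (`compIncl_outer_left`), since tensoring with an
object preserves colimits. Associativity and units come from `compIncl_inner`, `unit_compIncl` and
`compIncl_unit`. Relations (c) and (d) then say precisely that a graph morphism is an enriched
functor on the generators, so `P_cart` is `generatorsCategory` and the universal map `ι` is the
identity.

For coalgebras over an enriched category seen as an operad, all operations outside arity one are
initial, and so are their products with other objects. Only the unary structure maps carry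
information, and by adjunction they form an enriched functor. Both comparisons with algebras are
fully faithful and bijective on objects, hence isomorphisms of categories, and the first isomorphism
of the theorem is one comparison followed by the inverse of the other. -/

lemma associator_inv_fst {E : Type u} [Category.{v} E] [CartesianMonoidalCategory E] (X Y Z : E) :
    (α_ X Y Z).inv ≫ fst (X ⊗ Y) Z = X ◁ fst Y Z :=
  CartesianMonoidalCategory.hom_ext _ _ (by simp) (by simp)

/-! ### Coalgebras described by the components of their structure maps. -/

namespace OperadCoalgebra

section Components

variable {E : Type u} [Category.{v} E] [CartesianMonoidalCategory E] {C : Type w}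

/-- The type of the component depends on `insertEquiv i p`, so the value `s` is kept as a variable
tied to it by `hp`; after substitution the transport is trivial. -/
lemma prodInsert_π (V : C → E) (c : ColTuple C) (i : Fin c.len) (c' : ColTuple C) {d : C}
    (h : c.col i = d) {W : E} (t : V d ⊗ W ⟶ prodObj V c')
    (s : {k : Fin c.len // k ≠ i} ⊕ Fin c'.len) (p : Fin (c.insert i c').len)
    (hp : insertEquiv i p = s) :
    prodInsert V c i c' h t ≫ Pi.π (fun p => V ((c.insert i c').col p)) p =
      prodInsertAux V c i c' h t s ≫ eqToHom (by rw [← hp]; rfl) := by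
  subst hp
  exact (Pi.lift_π _ _).trans (Category.comp_id _).symm

lemma prodInsert_posOuter (V : C → E) (c : ColTuple C) (i : Fin c.len) (c' : ColTuple C) {d : C}
    (h : c.col i = d) {W : E} (t : V d ⊗ W ⟶ prodObj V c') (k : Fin c.len) (hk : k ≠ i) :
    prodInsert V c i c' h t ≫ Pi.π (fun p => V ((c.insert i c').col p)) (c.posOuter i c' k hk) =
      fst _ _ ≫ Pi.π _ k ≫ eqToHom (congrArg V (col_posOuter c i c' k hk).symm) :=
  (prodInsert_π V c i c' h t (.inl ⟨k, hk⟩) _ ((insertEquiv i).apply_symm_apply _)).trans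
    (Category.assoc _ _ _)

lemma prodInsert_posInner (V : C → E) (c : ColTuple C) (i : Fin c.len) (c' : ColTuple C) {d : C}
    (h : c.col i = d) {W : E} (t : V d ⊗ W ⟶ prodObj V c') (j : Fin c'.len) :
    prodInsert V c i c' h t ≫ Pi.π (fun p => V ((c.insert i c').col p)) (c.posInner i c' j) =
      (Pi.π _ i ≫ eqToHom (congrArg V h)) ▷ W ≫ t ≫ Pi.π (fun p => V (c'.col p)) j ≫
        eqToHom (congrArg V (col_posInner c i c' j).symm) :=
  (prodInsert_π V c i c' h t (.inr j) _ ((insertEquiv i).apply_symm_apply _)).trans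
    (by
      rw [prodInsertAux, Category.assoc]
      exact congrArg _ (Category.assoc _ _ _))

variable [BraidedCategory E] {P : EnrichedOperad E C}

/-- The component of the structure map of a coalgebra at a position `i` of colour `y`. -/
def coactAt (V : OperadCoalgebra P) (c : ColTuple C) (i : Fin c.len) {y : C} (h : c.col i = y)
    (x : C) : V.obj x ⊗ (P.seq x).obj (op c) ⟶ V.obj y :=
  V.coact c x ≫ Pi.π (fun p => V.obj (c.col p)) i ≫ eqToHom (congrArg V.obj h)

lemma coact_π (V : OperadCoalgebra P) (c : ColTuple C) (i : Fin c.len) (x : C) :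
    V.coact c x ≫ Pi.π (fun p => V.obj (c.col p)) i = V.coactAt c i rfl x := by
  simp [coactAt]

lemma coactAt_unit (V : OperadCoalgebra P) (x : C) :
    (ρ_ (V.obj x)).inv ≫ V.obj x ◁ P.η x ≫ V.coactAt (single x) (0 : Fin 1) rfl x =
      𝟙 (V.obj x) := by
  rw [← V.coact_unit x, ← coact_π]

lemma coactAt_permute (V : OperadCoalgebra P) {d c : ColTuple C} (f : d ⟶ c) (i : Fin d.len)
    {y : C} (h : d.col i = y) (x : C) :
    V.obj x ◁ (P.seq x).map f.op ≫ V.coactAt d i h x =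
      V.coactAt c (f.equiv i) ((f.col_equiv i).trans h) x := by
  subst h
  rw [coactAt, ← Category.assoc, V.coact_permute f x, coactAt, prodPermute]
  simp

/-- At a position other than `k`, `prodInsert` is a projection that forgets the second operation.
This is what makes the action respect relation (b). -/
lemma coactAt_outer (V : OperadCoalgebra P) (c : ColTuple C) (i : Fin c.len) {y : C}
    (h : c.col i = y) (k : Fin c.len) (hik : i ≠ k) (c' : ColTuple C) {d : C} (hk : c.col k = d)
    (x : C) :
    V.obj x ◁ P.γ c k c' hk x ≫ V.coactAt (c.insert k c') (c.posOuter k c' i hik)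
        ((col_posOuter c k c' i hik).trans h) x =
      V.obj x ◁ fst _ _ ≫ V.coactAt c i h x := by
  subst h
  rw [coactAt, ← Category.assoc, V.coact_comp, Category.assoc, Category.assoc,
    reassoc_of% prodInsert_posOuter]
  simp only [eqToHom_trans, eqToHom_refl, Category.comp_id, coactAt, whiskerRight_fst_assoc,
    reassoc_of% associator_inv_fst]

/-- At an inserted position, `prodInsert` projects to the factor `i` and then coacts by the second
operation. This is relation (c) before currying. -/
lemma coactAt_inner (V : OperadCoalgebra P) (c : ColTuple C) (i : Fin c.len) {d : C}
    (h : c.col i = d) (c' : ColTuple C) (j : Fin c'.len) {y : C} (h' : c'.col j = y) (x : C) :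
    V.obj x ◁ P.γ c i c' h x ≫ V.coactAt (c.insert i c') (c.posInner i c' j)
        ((col_posInner c i c' j).trans h') x =
      (α_ _ _ _).inv ≫ V.coactAt c i h x ▷ _ ≫ V.coactAt c' j h' d := by
  subst h'
  rw [coactAt, ← Category.assoc, V.coact_comp, Category.assoc, Category.assoc,
    reassoc_of% prodInsert_posInner]
  simp [coactAt]

/-- An isomorphism of categories requires honest equality of coalgebras, so the components are
compared along the equality of the underlying objects. -/
lemma ext_coactAt {V W : OperadCoalgebra P} (h : V.obj = W.obj)
    (h' : ∀ c i x, V.coactAt c i rfl x ≫ eqToHom (congrFun h _) =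
      eqToHom (congrFun h x) ▷ _ ≫ W.coactAt c i rfl x) : V = W := by
  have key : ∀ c x, HEq (V.coact c x) (W.coact c x) := by
    intro c x
    obtain ⟨o, a, _, _, _⟩ := V
    obtain ⟨o', a', _, _, _⟩ := W
    obtain rfl : o = o' := h
    refine heq_of_eq (Pi.hom_ext _ _ fun p => ?_)
    simpa [coactAt] using h' c p x
  obtain ⟨o, a, _, _, _⟩ := V
  obtain ⟨o', a', _, _, _⟩ := W
  obtain rfl : o = o' := h
  congr
  funext c x
  exact eq_of_heq (key c x)

/-- A coalgebra can be constructed from the components of its structure maps. -/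
def ofComponents (P : EnrichedOperad E C) (obj : C → E)
    (t : ∀ (c : ColTuple C) (i : Fin c.len) {y : C} (_ : c.col i = y) (x : C),
      obj x ⊗ (P.seq x).obj (op c) ⟶ obj y)
    (unit : ∀ x, (ρ_ (obj x)).inv ≫ obj x ◁ P.η x ≫ t (single x) (0 : Fin 1) rfl x = 𝟙 (obj x))
    (permute : ∀ {d c : ColTuple C} (f : d ⟶ c) (i : Fin d.len) {y : C} (h : d.col i = y) (x : C),
      obj x ◁ (P.seq x).map f.op ≫ t d i h x = t c (f.equiv i) ((f.col_equiv i).trans h) x)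
    (outer : ∀ (c : ColTuple C) (i : Fin c.len) {y : C} (h : c.col i = y) (k : Fin c.len)
      (hik : i ≠ k) (c' : ColTuple C) {d : C} (hk : c.col k = d) (x : C),
      obj x ◁ P.γ c k c' hk x ≫ t (c.insert k c') (c.posOuter k c' i hik)
        ((col_posOuter c k c' i hik).trans h) x = obj x ◁ fst _ _ ≫ t c i h x)
    (inner : ∀ (c : ColTuple C) (i : Fin c.len) {d : C} (h : c.col i = d) (c' : ColTuple C)
      (j : Fin c'.len) {y : C} (h' : c'.col j = y) (x : C),
      obj x ◁ P.γ c i c' h x ≫ t (c.insert i c') (c.posInner i c' j)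
        ((col_posInner c i c' j).trans h') x = (α_ _ _ _).inv ≫ t c i h x ▷ _ ≫ t c' j h' d) :
    OperadCoalgebra P where
  obj := obj
  coact c x := Pi.lift fun p => t c p rfl x
  coact_unit x := by
    rw [← unit x]
    congr 2
    exact Pi.lift_π _ _
  coact_permute {d c} f x := by
    refine Pi.hom_ext _ _ fun p => ?_
    -- The hypothesis `permute` lands in the colour `d.col p`, the projection in `c.col (f.equiv
    -- p)`; naturality of `t` in the equality of colours bridges them.
    have ht : ∀ {y z : C} (e : y = z) (h : c.col (f.equiv p) = y),
        t c (f.equiv p) (h.trans e) x = t c (f.equiv p) h x ≫ eqToHom (congrArg obj e) := by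
      rintro y _ rfl h
      simp
    simp only [prodPermute, Category.assoc, Pi.lift_π, Pi.lift_π_assoc, permute]
    exact ht (f.col_equiv p) rfl
  coact_comp c i c' d h x := by
    refine Pi.hom_ext _ _ fun p => ?_
    have ht : ∀ {y : C} (h : (c.insert i c').col p = y),
        t (c.insert i c') p rfl x =
          t (c.insert i c') p h x ≫ eqToHom (congrArg obj h.symm) := by
      rintro _ rfl
      simp
    have ht' : t c i h x = t c i rfl x ≫ eqToHom (congrArg obj h) := by
      subst h
      simp
    rw [Category.assoc, Pi.lift_π]
    -- Every position of the composed tuple is outer or inner, so `outer` and `inner` together cover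
    -- all components.
    obtain ⟨k, hk, rfl⟩ | ⟨j, rfl⟩ :
        (∃ k hk, p = c.posOuter i c' k hk) ∨ ∃ j, p = c.posInner i c' j := by
      obtain ⟨⟨k, hk⟩ | j, rfl⟩ := (insertEquiv i).symm.surjective p
      exacts [.inl ⟨k, hk, rfl⟩, .inr ⟨j, rfl⟩]
    · rw [ht (col_posOuter c i c' k hk), reassoc_of% outer c k rfl i hk c' h x]
      simp only [Category.assoc, prodInsert_posOuter, whiskerRight_fst_assoc, Pi.lift_π_assoc,
        reassoc_of% associator_inv_fst]
    · rw [ht (col_posInner c i c' j), reassoc_of% inner c i h c' j rfl x]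
      simp only [Category.assoc, prodInsert_posInner, ht', Pi.lift_π_assoc]
      simp only [← comp_whiskerRight_assoc, Pi.lift_π_assoc]

lemma ofComponents_coactAt (P : EnrichedOperad E C) (obj : C → E)
    (t : ∀ (c : ColTuple C) (i : Fin c.len) {y : C} (_ : c.col i = y) (x : C),
      obj x ⊗ (P.seq x).obj (op c) ⟶ obj y) (unit permute outer inner)
    (c : ColTuple C) (i : Fin c.len) {y : C} (h : c.col i = y) (x : C) :
    (ofComponents P obj t unit permute outer inner).coactAt c i h x = t c i h x := by
  subst h
  simp [coactAt, ofComponents]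

lemma Hom.comm_coactAt {V W : OperadCoalgebra P} (f : V ⟶ W) (c : ColTuple C) (i : Fin c.len)
    {y : C} (h : c.col i = y) (x : C) :
    V.coactAt c i h x ≫ Hom.app f y = Hom.app f x ▷ _ ≫ W.coactAt c i h x := by
  subst h
  have := Hom.comm f c x =≫ Pi.π _ i
  simpa [coactAt] using this

/-- A morphism of coalgebras can be constructed by checking the compatibility on the components
of the structure maps. -/
def Hom.ofComponents {V W : OperadCoalgebra P} (app : ∀ x, V.obj x ⟶ W.obj x)
    (comm : ∀ (c : ColTuple C) (i : Fin c.len) (x : C),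
      V.coactAt c i rfl x ≫ app (c.col i) = app x ▷ _ ≫ W.coactAt c i rfl x) : V ⟶ W where
  app := app
  comm c x := Pi.hom_ext _ _ fun p => by
    simpa [coactAt] using comm c p x

end Components

end OperadCoalgebra

/-! ### The graph of generators and the composition of marked operations. -/

section Generators

variable {E : Type u} [Category.{v} E] [CartesianMonoidalCategory E] [BraidedCategory E]
  [HasColimits E] {C : Type v} {P : EnrichedOperad E C} {x y : C} {Z : E}

lemma rawGenerators_hom_ext {f g : rawGenerators P x y ⟶ Z}
    (hfg : ∀ c i h, rawIncl P c i h x ≫ f = rawIncl P c i h x ≫ g) : f = g :=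
  Sigma.hom_ext _ _ fun s => hfg s.1 s.2.1 s.2.2

/-- Morphisms from the coproduct defining the generators. -/
def rawGeneratorsDesc (t : ∀ (c : ColTuple C) (i : Fin c.len), c.col i = y →
    ((P.seq x).obj (op c) ⟶ Z)) : rawGenerators P x y ⟶ Z :=
  Sigma.desc fun s => t s.1 s.2.1 s.2.2

lemma rawIncl_rawGeneratorsDesc (t : ∀ (c : ColTuple C) (i : Fin c.len), c.col i = y →
    ((P.seq x).obj (op c) ⟶ Z)) (c : ColTuple C) (i : Fin c.len) (h : c.col i = y) :
    rawIncl P c i h x ≫ rawGeneratorsDesc t = t c i h :=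
  Sigma.ι_desc _ _

lemma generators_condition (r : PermRel y ⊕ OuterRel y) :
    relLeft P x y r ≫ generatorsπ P x y = relRight P x y r ≫ generatorsπ P x y := by
  have := Sigma.ι (relObj P x y) r ≫=
    coequalizer.condition (Sigma.desc (relLeft P x y)) (Sigma.desc (relRight P x y))
  simp only [Sigma.ι_desc_assoc] at this
  exact this

lemma incl_permute {d c : ColTuple C} (f : d ⟶ c) (i : Fin d.len) (h : d.col i = y) :
    (P.seq x).map f.op ≫ incl P d i h x =
      incl P c (f.equiv i) ((f.col_equiv i).trans h) x :=
  (Category.assoc _ _ _).symm.trans (generators_condition (.inl ⟨d, c, f, i, h⟩)).symm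

lemma incl_outer (c : ColTuple C) (i : Fin c.len) (h : c.col i = y) (k : Fin c.len) (hik : i ≠ k)
    (c' : ColTuple C) {d : C} (hk : c.col k = d) :
    P.γ c k c' hk x ≫ incl P (c.insert k c') (c.posOuter k c' i hik)
      ((col_posOuter c k c' i hik).trans h) x = fst _ _ ≫ incl P c i h x := by
  subst hk
  exact (Category.assoc _ _ _).symm.trans <|
    (generators_condition (.inr ⟨c, i, h, k, hik, c'⟩)).symm.trans (Category.assoc _ _ _)

lemma generators_hom_ext {f g : generators P x y ⟶ Z}
    (hfg : ∀ c i h, incl P c i h x ≫ f = incl P c i h x ≫ g) : f = g :=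
  coequalizer.hom_ext <| rawGenerators_hom_ext fun c i h =>
    (Category.assoc _ _ _).symm.trans <| (hfg c i h).trans (Category.assoc _ _ _)

/-- Morphisms from the generators are defined on the operations with a marked position. -/
def generatorsDesc (t : ∀ (c : ColTuple C) (i : Fin c.len), c.col i = y →
      ((P.seq x).obj (op c) ⟶ Z))
    (permute : ∀ {d c : ColTuple C} (f : d ⟶ c) (i : Fin d.len) (h : d.col i = y),
      (P.seq x).map f.op ≫ t d i h = t c (f.equiv i) ((f.col_equiv i).trans h))
    (outer : ∀ (c : ColTuple C) (i : Fin c.len) (h : c.col i = y) (k : Fin c.len) (hik : i ≠ k)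
      (c' : ColTuple C),
      P.γ c k c' rfl x ≫ t (c.insert k c') (c.posOuter k c' i hik)
        ((col_posOuter c k c' i hik).trans h) = fst _ _ ≫ t c i h) :
    generators P x y ⟶ Z :=
  coequalizer.desc (rawGeneratorsDesc t) <| Sigma.hom_ext _ _ fun r => by
    rw [Sigma.ι_desc_assoc, Sigma.ι_desc_assoc]
    rcases r with ⟨d, c, f, i, h⟩ | ⟨c, i, h, k, hik, c'⟩
    · exact (rawIncl_rawGeneratorsDesc t _ _ _).trans <| (permute f i h).symm.trans <|
        (congrArg _ (rawIncl_rawGeneratorsDesc t _ _ _).symm).trans (Category.assoc _ _ _).symm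
    · exact (Category.assoc _ _ _).trans <|
        (congrArg _ (rawIncl_rawGeneratorsDesc t _ _ _)).trans <|
        (outer c i h k hik c').symm.trans <|
        (congrArg _ (rawIncl_rawGeneratorsDesc t _ _ _).symm).trans (Category.assoc _ _ _).symm

lemma incl_generatorsDesc (t : ∀ (c : ColTuple C) (i : Fin c.len), c.col i = y →
      ((P.seq x).obj (op c) ⟶ Z)) (permute outer)
    (c : ColTuple C) (i : Fin c.len) (h : c.col i = y) :
    incl P c i h x ≫ generatorsDesc t permute outer = t c i h :=
  (Category.assoc _ _ _).trans <| (congrArg _ (coequalizer.π_desc _ _)).trans (Sigma.ι_desc _ _)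

/-- The operad axioms hold up to transport along equalities of tuples. Inclusions absorb this
transport, and then only the numerical value of the marked position matters. -/
lemma incl_eqToHom {d c : ColTuple C} (e : d = c) (p : Fin d.len) (q : Fin c.len)
    (hpq : p.1 = q.1) (h : d.col p = y) (h' : c.col q = y) :
    (P.seq x).map (eqToHom e).op ≫ incl P d p h x = incl P c q h' x := by
  subst e
  obtain rfl : p = q := Fin.ext hpq
  simp

lemma insertHom_posInner {d c d' c' : ColTuple C} (f : d ⟶ c) (i : Fin d.len) (g : d' ⟶ c')
    (j : Fin d'.len) :
    (insertHom f i g).equiv (d.posInner i d' j) = c.posInner (f.equiv i) c' (g.equiv j) := by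
  exact congrArg (fun s => (insertEquiv (f.equiv i)).symm
    (Equiv.sumCongr (f.equiv.subtypeEquiv fun k => by simp) g.equiv s))
    ((insertEquiv i).apply_symm_apply (.inr j))

variable (P) in
/-- The composition of operations, at the position of the second tuple given by `j`. -/
def compIncl (c : ColTuple C) (i : Fin c.len) {d : C} (h : c.col i = d) (c' : ColTuple C)
    (j : Fin c'.len) (h' : c'.col j = y) (x : C) :
    (P.seq x).obj (op c) ⊗ (P.seq d).obj (op c') ⟶ generators P x y :=
  P.γ c i c' h x ≫ incl P (c.insert i c') (c.posInner i c' j) ((col_posInner c i c' j).trans h') x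

/-- Equivariance of `γ` turns the pair of permutations into the single permutation `insertHom f i
g`, which relation (a) absorbs. -/
lemma compIncl_permute {a c a' c' : ColTuple C} (f : a ⟶ c) (i : Fin a.len) {d : C}
    (h : a.col i = d) (g : a' ⟶ c') (j : Fin a'.len) (h' : a'.col j = y) :
    ((P.seq x).map f.op ⊗ₘ (P.seq d).map g.op) ≫ compIncl P a i h a' j h' x =
      compIncl P c (f.equiv i) ((f.col_equiv i).trans h) c' (g.equiv j)
        ((g.col_equiv j).trans h') x := by
  rw [compIncl, ← reassoc_of% P.γ_equivariant f i g h x, incl_permute]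
  simp only [insertHom_posInner]
  rfl

/-- Sequential associativity rewrites the inner composition at `k` as a last composition, performed
in `c ◁ᵢ c'` away from the marked position; relation (b) then removes it. -/
lemma compIncl_outer_right (c : ColTuple C) (i : Fin c.len) {d : C} (h : c.col i = d)
    (c' : ColTuple C) (j : Fin c'.len) (h' : c'.col j = y) (k : Fin c'.len) (hjk : j ≠ k)
    (c'' : ColTuple C) {d' : C} (hk : c'.col k = d') :
    _ ◁ P.γ c' k c'' hk d ≫ compIncl P c i h (c'.insert k c'') (c'.posOuter k c'' j hjk)
      ((col_posOuter c' k c'' j hjk).trans h') x = _ ◁ fst _ _ ≫ compIncl P c i h c' j h' x := by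
  have hjk' : c.posInner i c' j ≠ c.posInner i c' k := fun e => hjk <| Fin.ext <| by
    simpa [posInner_val] using congrArg Fin.val e
  -- The two bracketings must mark the same position, which is checked on natural numbers.
  have hv : ((c.insert i c').posOuter (c.posInner i c' k) c'' (c.posInner i c' j) hjk').1 =
      (c.posInner i (c'.insert k c'') (c'.posOuter k c'' j hjk)).1 := by
    have : j.1 ≠ k.1 := fun e => hjk (Fin.ext e)
    have h₁ := c.posInner_val i c' j
    have h₂ := c.posInner_val i c' k
    have h₃ := c'.posOuter_val k c'' j hjk
    have h₄ := c.posInner_val i (c'.insert k c'') (c'.posOuter k c'' j hjk)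
    have h₅ := (c.insert i c').posOuter_val _ c'' _ hjk'
    split_ifs at h₃ h₅ <;> omega
  have h₁ := P.γ_γ_inner c i c' k c'' h hk x
  have h₂ := incl_outer (P := P) (x := x) (c.insert i c') (c.posInner i c' j)
    ((col_posInner _ _ _ _).trans h') (c.posInner i c' k) hjk' c''
    ((col_posInner _ _ _ _).trans hk)
  rw [← cancel_epi (α_ _ _ _).hom, compIncl, ← incl_eqToHom (insert_insert_inner c i c' k c'') _ _
    hv ((col_posOuter _ _ _ _ _).trans ((col_posInner _ _ _ _).trans h')), ← reassoc_of% h₁, h₂,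
    whiskerRight_fst_assoc, compIncl, ← reassoc_of% associator_inv_fst, Iso.hom_inv_id_assoc]

/-- Parallel associativity exchanges the compositions at `i` and `k`, so that the one at `k` comes
last and is removed by relation (b). -/
lemma compIncl_outer_left (c : ColTuple C) (i : Fin c.len) {d : C} (h : c.col i = d)
    (c' : ColTuple C) (j : Fin c'.len) (h' : c'.col j = y) (k : Fin c.len) (hik : i ≠ k)
    (c'' : ColTuple C) {d' : C} (hk : c.col k = d') :
    P.γ c k c'' hk x ▷ _ ≫ compIncl P (c.insert k c'') (c.posOuter k c'' i hik)
      ((col_posOuter c k c'' i hik).trans h) c' j h' x =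
        fst _ _ ▷ _ ≫ compIncl P c i h c' j h' x := by
  have hjk' : c.posInner i c' j ≠ c.posOuter i c' k hik.symm := fun e => by
    have := (insertEquiv i).symm.injective e
    simp at this
  have hv : ((c.insert i c').posOuter (c.posOuter i c' k hik.symm) c'' (c.posInner i c' j) hjk').1 =
      ((c.insert k c'').posInner (c.posOuter k c'' i hik) c' j).1 := by
    have : i.1 ≠ k.1 := fun e => hik (Fin.ext e)
    have h₁ := c.posInner_val i c' j
    have h₂ := c.posOuter_val i c' k hik.symm
    have h₃ := c.posOuter_val k c'' i hik
    have h₄ := (c.insert k c'').posInner_val (c.posOuter k c'' i hik) c' j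
    have h₅ := (c.insert i c').posOuter_val _ c'' _ hjk'
    split_ifs at h₂ h₃ h₅ <;> omega
  have h₁ := P.γ_γ_outer c k i hik.symm c'' c' hk h x
  have h₂ := incl_outer (P := P) (x := x) (c.insert i c') (c.posInner i c' j)
    ((col_posInner _ _ _ _).trans h') (c.posOuter i c' k hik.symm) hjk' c''
    ((col_posOuter _ _ _ _ _).trans hk)
  rw [compIncl, reassoc_of% h₁, incl_eqToHom (insert_insert_outer c k i hik.symm c'' c') _ _
    hv.symm _ ((col_posOuter _ _ _ _ _).trans ((col_posInner _ _ _ _).trans h')), h₂,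
    whiskerRight_fst_assoc, compIncl]
  simp only [← Category.assoc]
  congr 2
  -- What remains is that reordering a triple product and then forgetting the last factor is the
  -- same as forgetting the middle one.
  exact CartesianMonoidalCategory.hom_ext _ _ (by simp) (by simp)

/-- Sequential associativity along the marked positions; it becomes associativity in the category of
generators. -/
lemma compIncl_inner (c : ColTuple C) (i : Fin c.len) {d : C} (h : c.col i = d)
    (c' : ColTuple C) (j : Fin c'.len) {d' : C} (h' : c'.col j = d') (c'' : ColTuple C)
    (k : Fin c''.len) (h'' : c''.col k = y) :
    P.γ c i c' h x ▷ _ ≫ compIncl P (c.insert i c') (c.posInner i c' j)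
      ((col_posInner c i c' j).trans h') c'' k h'' x =
    (α_ _ _ _).hom ≫ _ ◁ P.γ c' j c'' h' d ≫ compIncl P c i h (c'.insert j c'')
      (c'.posInner j c'' k) ((col_posInner c' j c'' k).trans h'') x := by
  rw [compIncl, reassoc_of% P.γ_γ_inner c i c' j c'' h h' x, incl_eqToHom, compIncl]
  simp only [posInner_val]
  omega

lemma unit_compIncl (c : ColTuple C) (i : Fin c.len) (h : c.col i = y) :
    (λ_ _).inv ≫ P.η x ▷ _ ≫ compIncl P (single x) (0 : Fin 1) rfl c i h x = incl P c i h x := by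
  rw [compIncl, reassoc_of% P.η_γ c x, incl_eqToHom]
  simp [posInner_val]

lemma compIncl_unit (c : ColTuple C) (i : Fin c.len) (h : c.col i = y) :
    (ρ_ _).inv ≫ _ ◁ P.η y ≫ compIncl P c i h (single y) (0 : Fin 1) rfl x = incl P c i h x := by
  rw [compIncl, reassoc_of% P.γ_η c i h x, incl_eqToHom]
  simp [posInner_val]

/-! ### Descent of the composition to the quotients, and the enriched category of generators. -/

variable [MonoidalClosed E] {A : E}

/-- Closedness enters here: by currying, the inclusions remain jointly epic after tensoring with
`A`. -/
lemma tensor_generators_hom_ext {f g : A ⊗ generators P x y ⟶ Z}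
    (hfg : ∀ c i h, A ◁ incl P c i h x ≫ f = A ◁ incl P c i h x ≫ g) : f = g := by
  refine curry_injective (generators_hom_ext fun c i h => ?_)
  rw [← curry_natural_left, ← curry_natural_left, hfg]

lemma generators_tensor_hom_ext {f g : generators P x y ⊗ A ⟶ Z}
    (hfg : ∀ c i h, incl P c i h x ▷ A ≫ f = incl P c i h x ▷ A ≫ g) : f = g := by
  rw [← cancel_epi (β_ A _).hom]
  refine tensor_generators_hom_ext fun c i h => ?_
  simp [hfg]

lemma generators_tensor_generators_hom_ext {a b : C}
    {f g : generators P x y ⊗ generators P a b ⟶ Z}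
    (hfg : ∀ c i h c' j h', (incl P c i h x ⊗ₘ incl P c' j h' a) ≫ f =
      (incl P c i h x ⊗ₘ incl P c' j h' a) ≫ g) : f = g := by
  refine generators_tensor_hom_ext fun c i h => tensor_generators_hom_ext fun c' j h' => ?_
  simpa [tensorHom_def'] using hfg c i h c' j h'

lemma generators_triple_hom_ext {a b a' b' : C}
    {f g : (generators P x y ⊗ generators P a b) ⊗ generators P a' b' ⟶ Z}
    (hfg : ∀ c i h c' j h' c'' k h'',
      ((incl P c i h x ⊗ₘ incl P c' j h' a) ⊗ₘ incl P c'' k h'' a') ≫ f =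
        ((incl P c i h x ⊗ₘ incl P c' j h' a) ⊗ₘ incl P c'' k h'' a') ≫ g) : f = g := by
  refine tensor_generators_hom_ext fun c'' k h'' => ?_
  -- Currying leaves the right-hand factor free, so the pair of generators is first braided into
  -- that place.
  rw [← cancel_epi (β_ _ _).hom]
  refine curry_injective (generators_tensor_generators_hom_ext fun c i h c' j h' => ?_)
  rw [← curry_natural_left, ← curry_natural_left]
  congr 1
  have := hfg c i h c' j h' c'' k h''
  simp only [MonoidalCategory.tensorHom_def (incl P c i h x ⊗ₘ incl P c' j h' a),
    Category.assoc] at this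
  rw [BraidedCategory.braiding_naturality_right_assoc, this,
    BraidedCategory.braiding_naturality_right_assoc]

variable (P) in
/-- The composition of an operation with generators. -/
def compGeneratorsAux (y : C) (c : ColTuple C) (i : Fin c.len) {d : C} (h : c.col i = d) (x : C) :
    (P.seq x).obj (op c) ⊗ generators P d y ⟶ generators P x y :=
  uncurry <| generatorsDesc (fun c' j h' => curry <| compIncl P c i h c' j h' x)
    (fun f j h' => by
      rw [← curry_natural_left]
      congr 1
      have := compIncl_permute (P := P) (x := x) (𝟙 c) i h f j h'
      rwa [op_id, CategoryTheory.Functor.map_id, id_tensorHom] at this)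
    (fun c' j h' k hjk c'' => by
      rw [← curry_natural_left, ← curry_natural_left, compIncl_outer_right])

lemma whiskerLeft_incl_compGeneratorsAux (c : ColTuple C) (i : Fin c.len) {d : C} (h : c.col i = d)
    (c' : ColTuple C) (j : Fin c'.len) (h' : c'.col j = y) :
    _ ◁ incl P c' j h' d ≫ compGeneratorsAux P y c i h x = compIncl P c i h c' j h' x := by
  rw [compGeneratorsAux, ← uncurry_natural_left, incl_generatorsDesc, uncurry_curry]

variable (P) in
/-- The composition of generators. -/
def compGenerators (x d y : C) : generators P x d ⊗ generators P d y ⟶ generators P x y :=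
  -- The right variable is already extended by `compGeneratorsAux`. The left one is braided to the
  -- right before it is extended by the same adjunction.
  (β_ _ _).hom ≫ uncurry (generatorsDesc
    (fun c i h => curry <| (β_ _ _).hom ≫ compGeneratorsAux P y c i h x)
    (fun f i h => by
      rw [← curry_natural_left]
      congr 1
      rw [BraidedCategory.braiding_naturality_right_assoc]
      congr 1
      refine tensor_generators_hom_ext fun c' j h' => ?_
      rw [whisker_exchange_assoc, whiskerLeft_incl_compGeneratorsAux,
        whiskerLeft_incl_compGeneratorsAux]
      have := compIncl_permute (P := P) (x := x) f i h (𝟙 c') j h'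
      rwa [op_id, CategoryTheory.Functor.map_id, tensorHom_id] at this)
    (fun c i h k hik c'' => by
      rw [← curry_natural_left, ← curry_natural_left]
      congr 1
      rw [BraidedCategory.braiding_naturality_right_assoc,
        BraidedCategory.braiding_naturality_right_assoc]
      congr 1
      refine tensor_generators_hom_ext fun c' j h' => ?_
      rw [whisker_exchange_assoc, whisker_exchange_assoc, whiskerLeft_incl_compGeneratorsAux,
        whiskerLeft_incl_compGeneratorsAux, compIncl_outer_left]))

lemma incl_compGenerators (c : ColTuple C) (i : Fin c.len) {d : C} (h : c.col i = d)
    (c' : ColTuple C) (j : Fin c'.len) (h' : c'.col j = y) :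
    (incl P c i h x ⊗ₘ incl P c' j h' d) ≫ compGenerators P x d y =
      compIncl P c i h c' j h' x := by
  rw [tensorHom_def', Category.assoc, compGenerators,
    BraidedCategory.braiding_naturality_left_assoc, ← uncurry_natural_left, incl_generatorsDesc,
    uncurry_curry, SymmetricCategory.symmetry_assoc, whiskerLeft_incl_compGeneratorsAux]

variable (P) in
/-- The graph of generators is an enriched category. -/
@[reducible]
def generatorsCategory : EnrichedCategory E C where
  Hom := generators P
  id x := P.η x ≫ incl P (single x) (0 : Fin 1) rfl x
  comp := compGenerators P
  id_comp x y := generators_hom_ext fun c i h => by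
    rw [leftUnitor_inv_naturality_assoc, comp_whiskerRight, Category.assoc,
      whisker_exchange_assoc, ← tensorHom_def'_assoc, incl_compGenerators, unit_compIncl,
      Category.comp_id]
  comp_id x y := generators_hom_ext fun c i h => by
    rw [rightUnitor_inv_naturality_assoc, MonoidalCategory.whiskerLeft_comp, Category.assoc,
      ← whisker_exchange_assoc, ← tensorHom_def_assoc, incl_compGenerators, compIncl_unit,
      Category.comp_id]
  assoc w x y z := by
    -- Tested on triples of marked operations, both sides become iterated partial compositions,
    -- compared by `compIncl_inner`.
    rw [← cancel_epi (α_ _ _ _).hom, Iso.hom_inv_id_assoc]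
    refine generators_triple_hom_ext fun c i h c' j h' c'' k h'' => ?_
    rw [MonoidalCategory.associator_naturality_assoc]
    simp only [← tensorHom_id, ← id_tensorHom, tensorHom_comp_tensorHom_assoc,
      Category.comp_id, incl_compGenerators]
    have h₁ : (compIncl P c i h c' j h' w ⊗ₘ incl P c'' k h'' y) = P.γ c i c' h w ▷ _ ≫
        (incl P _ _ ((col_posInner c i c' j).trans h') w ⊗ₘ incl P c'' k h'' y) := by
      rw [compIncl, ← tensorHom_id, tensorHom_comp_tensorHom, Category.id_comp]
    have h₂ : (incl P c i h w ⊗ₘ compIncl P c' j h' c'' k h'' x) = _ ◁ P.γ c' j c'' h' x ≫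
        (incl P c i h w ⊗ₘ incl P _ _ ((col_posInner c' j c'' k).trans h'') x) := by
      rw [compIncl, ← id_tensorHom, tensorHom_comp_tensorHom, Category.id_comp]
    rw [h₁, h₂, Category.assoc, Category.assoc, incl_compGenerators, incl_compGenerators,
      compIncl_inner]

end Generators

/-! ### The enrichment of the closed category over itself, in uncurried form. -/

section SelfEnrichment

variable {E : Type u} [Category.{v} E] [MonoidalCategory E] [MonoidalClosed E]

/-- Composition of internal homs is adjoint to acting successively; this translates relation (c)
into `coactAt_inner` and back. -/
lemma curry_tensorHom_curry_eComp {X Y Z A B : E} (a : X ⊗ A ⟶ Y) (b : Y ⊗ B ⟶ Z) :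
    (curry a ⊗ₘ curry b) ≫ eComp E X Y Z = curry ((α_ _ _ _).inv ≫ a ▷ _ ≫ b) := by
  rw [enrichedCategorySelf_comp, MonoidalClosed.comp_eq, ← curry_natural_left,
    MonoidalClosed.compTranspose_eq]
  congr 1
  simp only [MonoidalCategory.tensorHom_def, MonoidalCategory.whiskerLeft_comp, Category.assoc,
    associator_inv_naturality_right_assoc, associator_inv_naturality_middle_assoc,
    whisker_exchange_assoc, whiskerLeft_curry_ihom_ev_app, ← comp_whiskerRight_assoc]
  exact congrArg (fun f => (α_ X A B).inv ≫ a ▷ B ≫ f) (whiskerLeft_curry_ihom_ev_app _ _ b)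

lemma eId_eq_curry (X : E) : eId E X = curry (ρ_ X).hom := rfl

/-- Enriched naturality is the adjoint form of compatibility with the actions, which links natural
transformations with coalgebra morphisms. -/
lemma comp_ihom_map_eq_comp_pre_iff {X X' Y Y' A : E} (a : A ⟶ (ihom X).obj Y)
    (b : A ⟶ (ihom X').obj Y')
    (f : X ⟶ X') (g : Y ⟶ Y') :
    a ≫ (ihom X).map g = b ≫ (pre f).app Y' ↔ uncurry a ≫ g = f ▷ _ ≫ uncurry b := by
  rw [← uncurry_injective.eq_iff, uncurry_natural_right, uncurry_natural_left, uncurry_pre,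
    whisker_exchange_assoc, ← uncurry_eq]

lemma uncurry_enrichedFunctor_map_eqToHom {A : Type w} [EnrichedCategory E A]
    {F G : EnrichedFunctor E A E} (h : F = G) (x y : A) {Z : E} (a : Z ⟶ (x ⟶[E] y)) :
    uncurry (a ≫ F.map x y) ≫ eqToHom (by rw [h]) =
      eqToHom (by rw [h]) ▷ Z ≫ uncurry (a ≫ G.map x y) := by
  subst h
  simp

end SelfEnrichment

/-! ### The universal property of the category of generators. -/

section Presentation

variable {E : Type u} [Category.{v} E] [CartesianMonoidalCategory E] [BraidedCategory E]
  [HasColimits E] {C : Type v} {P : EnrichedOperad E C}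

lemma SatisfiesRelations.compIncl_map {B : Type w} [EnrichedCategory E B]
    {φ : GraphHom (generators P) B} (hφ : SatisfiesRelations φ) (c : ColTuple C) (i : Fin c.len)
    (c' : ColTuple C) (j : Fin c'.len) {d y : C} (h : c.col i = d) (h' : c'.col j = y) (x : C) :
    compIncl P c i h c' j h' x ≫ φ.map x y =
      (incl P c i h x ⊗ₘ incl P c' j h' d) ≫ (φ.map x d ⊗ₘ φ.map d y) ≫
        eComp E (φ.obj x) (φ.obj d) (φ.obj y) := by
  rw [← hφ.comp, compIncl, Category.assoc]

variable [MonoidalClosed E]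

lemma satisfiesRelations_generatorsCategory (P : EnrichedOperad E C) :
    letI := generatorsCategory P
    SatisfiesRelations (GraphHom.ofId fun x y : C => 𝟙 (generators P x y)) :=
  letI := generatorsCategory P
  { comp c i c' j d y h h' x := by
      have := incl_compGenerators (P := P) (x := x) c i h c' j h'
      simp only [GraphHom.ofId]
      erw [id_tensorHom_id, Category.id_comp, Category.comp_id]
      exact this.symm
    unit x := by
      simp only [GraphHom.ofId]
      erw [Category.comp_id]
      rfl }

variable [EnrichedCategory E C] {ι : ∀ x y : C, generators P x y ⟶ (x ⟶[E] y)}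
  [∀ x y, IsIso (ι x y)]

/-- A morphism from the graph of generators which satisfies the relations extends to an
enriched functor. -/
@[simps]
def SatisfiesRelations.toFunctor (hι : SatisfiesRelations (GraphHom.ofId ι)) {B : Type w}
    [EnrichedCategory E B] {φ : GraphHom (generators P) B} (hφ : SatisfiesRelations φ) :
    EnrichedFunctor E C B where
  obj := φ.obj
  map x y := inv (ι x y) ≫ φ.map x y
  map_id x := by
    have := hι.unit x
    simp only [GraphHom.ofId] at this
    rw [← this]
    simp [hφ.unit x]
  map_comp x d y := by
    -- Since `ι` is invertible, functoriality can be tested on pairs of generators, where it follows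
    -- from relation (c) for `ι` and for `φ`.
    rw [← cancel_epi (ι x d ⊗ₘ ι d y), tensorHom_comp_tensorHom_assoc, IsIso.hom_inv_id_assoc,
      IsIso.hom_inv_id_assoc]
    refine generators_tensor_generators_hom_ext fun c i h c' j h' => ?_
    have := hι.compIncl_map c i c' j h h' x
    simp only [GraphHom.ofId] at this
    rw [← hφ.compIncl_map, ← reassoc_of% this, IsIso.hom_inv_id_assoc]

/-- Existence is `toFunctor`. Uniqueness holds because `ι` is invertible and the identity on
objects, so the maps of the functor are forced. -/
lemma isCartPresentation (hι : SatisfiesRelations (GraphHom.ofId ι)) :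
    IsCartPresentation.{w} ι where
  relations := hι
  universal B _ φ hφ := by
    refine ⟨hι.toFunctor hφ, GraphHom.ext rfl (heq_of_eq ?_), ?_⟩
    · funext x y
      exact IsIso.hom_inv_id_assoc (ι x y) _
    · rintro F rfl
      obtain ⟨o, m, _, _⟩ := F
      simp [SatisfiesRelations.toFunctor, GraphHom.comp, GraphHom.ofId]

end Presentation

/-! ### Coalgebras over the operad as algebras over its category of generators. -/

section Action

variable {E : Type u} [Category.{v} E] [CartesianMonoidalCategory E] [BraidedCategory E]
  [HasColimits E] {C : Type v} {P : EnrichedOperad E C} [MonoidalClosed E]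

namespace OperadCoalgebra

/-- The action of the generators on a coalgebra. -/
def actionMap (V : OperadCoalgebra P) (x y : C) :
    generators P x y ⟶ (ihom (V.obj x)).obj (V.obj y) :=
  generatorsDesc (fun c i h => curry (V.coactAt c i h x))
    (fun f i h => by rw [← curry_natural_left, V.coactAt_permute])
    (fun c i h k hik c' => by rw [← curry_natural_left, ← curry_natural_left, V.coactAt_outer])

lemma incl_actionMap (V : OperadCoalgebra P) (c : ColTuple C) (i : Fin c.len)
    {y : C} (h : c.col i = y) (x : C) :
    incl P c i h x ≫ V.actionMap x y = curry (V.coactAt c i h x) := by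
  rw [actionMap, incl_generatorsDesc]

/-- The graph morphism given by the action of the generators on a coalgebra. -/
@[simps]
def action (V : OperadCoalgebra P) : GraphHom (generators P) E where
  obj := V.obj
  map := V.actionMap

lemma satisfiesRelations_action (V : OperadCoalgebra P) : SatisfiesRelations V.action where
  comp c i c' j d y h h' x := by
    have h₁ : (incl P c i h x ⊗ₘ incl P c' j h' d) ≫ (V.actionMap x d ⊗ₘ V.actionMap d y) =
        (curry (V.coactAt c i h x) ⊗ₘ curry (V.coactAt c' j h' d)) := by
      rw [tensorHom_comp_tensorHom, incl_actionMap, incl_actionMap]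
    refine (congrArg _ (V.incl_actionMap _ _ _ x)).trans <| (curry_natural_left _ _).symm.trans <|
      (congrArg curry (V.coactAt_inner c i h c' j h' x)).trans <|
      (curry_tensorHom_curry_eComp _ _).symm.trans ?_
    exact (congrArg (· ≫ eComp E (V.obj x) (V.obj d) (V.obj y)) h₁.symm).trans
      (Category.assoc _ _ _)
  unit x := by
    have h₁ : V.obj x ◁ P.η x ≫ V.coactAt (single x) (0 : Fin 1) rfl x = (ρ_ (V.obj x)).hom :=
      (Iso.inv_comp_eq _).1 (V.coactAt_unit x) |>.trans (Category.comp_id _)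
    exact (congrArg _ (V.incl_actionMap _ _ _ x)).trans <| (curry_natural_left _ _).symm.trans <|
      congrArg curry h₁

lemma generatorsπ_actionMap (V : OperadCoalgebra P) (x y : C) :
    generatorsπ P x y ≫ V.actionMap x y = V.rawAction.map x y :=
  rawGenerators_hom_ext fun c i h =>
    (Category.assoc _ _ _).symm.trans <| (V.incl_actionMap c i h x).trans
      (rawIncl_rawGeneratorsDesc (Z := (ihom (V.obj x)).obj (V.obj y))
        (fun c i h => curry (V.coactAt c i h x)) c i h).symm

end OperadCoalgebra

variable [EnrichedCategory E C] {ι : ∀ x y : C, generators P x y ⟶ (x ⟶[E] y)}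
  [∀ x y, IsIso (ι x y)]

variable (ι) in
-- As `ι` is invertible and the inclusions are jointly epic, naturality can be tested on marked
-- operations.
lemma enrichedFunctor_naturality_iff (F G : EnrichedFunctor E C E) (x y : C)
    (f : F.obj x ⟶ G.obj x) (g : F.obj y ⟶ G.obj y) :
    F.map x y ≫ (ihom (F.obj x)).map g = G.map x y ≫ (pre f).app (G.obj y) ↔
      ∀ c i h, uncurry (incl P c i h x ≫ ι x y ≫ F.map x y) ≫ g =
        f ▷ _ ≫ uncurry (incl P c i h x ≫ ι x y ≫ G.map x y) := by
  constructor
  · intro h c i hc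
    rw [← comp_ihom_map_eq_comp_pre_iff]
    simp only [Category.assoc]
    congr 2
  · intro h
    rw [← cancel_epi (ι x y)]
    refine generators_hom_ext fun c i hc => ?_
    have := (comp_ihom_map_eq_comp_pre_iff _ _ _ _).2 (h c i hc)
    simpa using this

namespace OperadCoalgebra

/-- The enriched functor associated with a coalgebra over an operad. -/
@[simps! obj]
def toEnrichedFunctor (hι : SatisfiesRelations (GraphHom.ofId ι)) (V : OperadCoalgebra P) :
    EnrichedFunctor E C E :=
  hι.toFunctor V.satisfiesRelations_action

lemma ι_toEnrichedFunctor_map (hι : SatisfiesRelations (GraphHom.ofId ι)) (V : OperadCoalgebra P)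
    (x y : C) : ι x y ≫ (V.toEnrichedFunctor hι).map x y = V.actionMap x y :=
  IsIso.hom_inv_id_assoc (ι x y) (V.actionMap x y)

lemma uncurry_incl_toEnrichedFunctor_map (hι : SatisfiesRelations (GraphHom.ofId ι))
    (V : OperadCoalgebra P) (c : ColTuple C) (i : Fin c.len) {y : C} (h : c.col i = y) (x : C) :
    uncurry (incl P c i h x ≫ ι x y ≫ (V.toEnrichedFunctor hι).map x y) = V.coactAt c i h x :=
  (congrArg uncurry ((congrArg _ (V.ι_toEnrichedFunctor_map hι x y)).trans
    (V.incl_actionMap c i h x))).trans (uncurry_curry _)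

lemma toEnrichedFunctor_naturality_iff (hι : SatisfiesRelations (GraphHom.ofId ι))
    {V W : OperadCoalgebra P} (f : ∀ x, V.obj x ⟶ W.obj x) (x y : C) :
    (V.toEnrichedFunctor hι).map x y ≫ (ihom (V.obj x)).map (f y) =
        (W.toEnrichedFunctor hι).map x y ≫ (pre (f x)).app (W.obj y) ↔
      ∀ (c : ColTuple C) (i : Fin c.len) (h : c.col i = y),
        V.coactAt c i h x ≫ f y = f x ▷ _ ≫ W.coactAt c i h x := by
  have := enrichedFunctor_naturality_iff (P := P) ι (V.toEnrichedFunctor hι)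
    (W.toEnrichedFunctor hι) x y (f x) (f y)
  simp only [uncurry_incl_toEnrichedFunctor_map] at this
  exact this

/-- The functor from coalgebras over an operad to algebras over the category presented by the
graph of generators. -/
def toCatAlgebra (hι : SatisfiesRelations (GraphHom.ofId ι)) :
    OperadCoalgebra P ⥤ CatAlgebra E C where
  obj V := ⟨V.toEnrichedFunctor hι⟩
  map {V W} f := ⟨Hom.app f, fun x y => (toEnrichedFunctor_naturality_iff hι (Hom.app f) x y).2
    fun c i h => Hom.comm_coactAt f c i h x⟩

/-- The coalgebra associated with an enriched functor. -/
def ofEnrichedFunctor (hι : SatisfiesRelations (GraphHom.ofId ι)) (F : EnrichedFunctor E C E) :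
    OperadCoalgebra P :=
  ofComponents P F.obj (fun c i y h x => uncurry (incl P c i h x ≫ ι x y ≫ F.map x y))
    (fun x => by
      have := hι.unit x
      simp only [GraphHom.ofId] at this
      rw [← uncurry_natural_left, ← cancel_epi (ρ_ _).hom, Iso.hom_inv_id_assoc,
        reassoc_of% this, F.map_id, eId_eq_curry, uncurry_curry, Category.comp_id])
    (fun f i y h x => by rw [← uncurry_natural_left, reassoc_of% incl_permute])
    (fun c i y h k hik c' d hk x => by
      rw [← uncurry_natural_left, ← uncurry_natural_left, reassoc_of% incl_outer])
    (fun c i d h c' j y h' x => by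
      have := hι.comp c i c' j h h' x
      simp only [GraphHom.ofId] at this
      rw [← uncurry_natural_left, reassoc_of% this, F.map_comp, tensorHom_comp_tensorHom_assoc,
        tensorHom_comp_tensorHom_assoc]
      -- Functoriality of `F` has produced a composite in the self-enrichment, which is unfolded
      -- into successive actions.
      apply curry_injective
      rw [← curry_tensorHom_curry_eComp]
      simp)

/-- A coalgebra and its functor share their objects, and the components of the former are the
uncurried values of the latter on marked operations. Each therefore determines the other, and their
morphisms satisfy the same condition. -/
instance (hι : SatisfiesRelations (GraphHom.ofId ι)) : (toCatAlgebra hι).IsIso where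
  faithful := ⟨fun {V W f g} h => Hom.ext (congrArg CatAlgebra.Hom.app h)⟩
  full := ⟨fun {V W} f => ⟨Hom.ofComponents (CatAlgebra.Hom.app f) fun c i x =>
    (toEnrichedFunctor_naturality_iff hι (CatAlgebra.Hom.app f) x _).1
      (CatAlgebra.Hom.naturality f x _) c i rfl, rfl⟩⟩
  bijective_obj := by
    refine ⟨fun V W h => ?_, fun F => ⟨ofEnrichedFunctor hι F.toFunctor, ?_⟩⟩
    · have h : V.toEnrichedFunctor hι = W.toEnrichedFunctor hι := congrArg CatAlgebra.toFunctor h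
      refine ext_coactAt (congrArg EnrichedFunctor.obj h) fun c i x => ?_
      have := uncurry_enrichedFunctor_map_eqToHom h x _ (incl P c i rfl x ≫ ι x _)
      rwa [Category.assoc, Category.assoc, uncurry_incl_toEnrichedFunctor_map,
        uncurry_incl_toEnrichedFunctor_map] at this
    · obtain ⟨F⟩ := F
      refine congrArg CatAlgebra.mk (EnrichedFunctor.ext E (fun _ => rfl) fun x y => ?_)
      refine (Category.comp_id _).trans ?_
      refine (cancel_epi (Z := (ihom (F.obj x)).obj (F.obj y)) (ι x y)).1 <|
        generators_hom_ext fun c i h => uncurry_injective ?_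
      exact (uncurry_incl_toEnrichedFunctor_map hι _ c i h x).trans
        (ofComponents_coactAt _ _ _ _ _ _ _ c i h x)

end OperadCoalgebra

end Action

lemma ColTuple.col_zero_eq {C : Type w} {c : ColTuple C} (hc : c.len = 1) {i : Fin c.len} {y : C}
    (h : c.col i = y) : c.col ⟨0, by omega⟩ = y := by
  rw [← h]
  congr 1
  ext
  dsimp only
  omega

/-- Composition in the opposite category is composition after a braiding, and the braiding of a
cartesian category is symmetric. -/
lemma eComp_eq_braiding_eComp_op {E : Type u} [Category.{v} E] [CartesianMonoidalCategory E]
    [BraidedCategory E] {A : Type w} [EnrichedCategory E A] (x y z : A) :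
    eComp E x y z = (β_ (x ⟶[E] y) (y ⟶[E] z)).hom ≫ eComp E (op z) (op y) (op x) :=
  (SymmetricCategory.symmetry_assoc (x ⟶[E] y) (y ⟶[E] z) (eComp E x y z)).symm

/-! ### Coalgebras over an enriched category seen as a unary operad. -/

section Unary

variable {E : Type u} [Category.{v} E] [CartesianMonoidalCategory E] [BraidedCategory E]
  [MonoidalClosed E] [HasInitial E] {B : Type w} [EnrichedCategory E B]

namespace OperadCoalgebra

/-- The component of the structure map at a position, with source written in terms of `unaryObj`. -/
def coactUnaryObj (V : OperadCoalgebra (EnrichedOperad.ofCategory E B)) (c : ColTuple B)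
    (i : Fin c.len) {y : B} (h : c.col i = y) (x : B) : V.obj x ⊗ unaryObj c x ⟶ V.obj y :=
  V.coactAt c i h x

lemma coactUnaryObj_unit (V : OperadCoalgebra (EnrichedOperad.ofCategory E B)) (x : B) :
    (ρ_ (V.obj x)).inv ≫ V.obj x ◁ (eId E x ≫ (unaryIso (single x) x rfl rfl).inv) ≫
      V.coactUnaryObj (single x) (0 : Fin 1) rfl x = 𝟙 _ :=
  V.coactAt_unit x

lemma coactUnaryObj_inner (V : OperadCoalgebra (EnrichedOperad.ofCategory E B))
    (c : ColTuple B) (i : Fin c.len) {d : B} (h : c.col i = d) (c' : ColTuple B) (j : Fin c'.len)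
    {y : B} (h' : c'.col j = y) (x : B) :
    V.obj x ◁ unaryComp c i c' h x ≫ V.coactUnaryObj (c.insert i c') (c.posInner i c' j)
        ((col_posInner c i c' j).trans h') x =
      (α_ _ _ _).inv ≫ V.coactUnaryObj c i h x ▷ _ ≫ V.coactUnaryObj c' j h' d :=
  V.coactAt_inner c i h c' j h' x

lemma Hom.comm_coactUnaryObj {V W : OperadCoalgebra (EnrichedOperad.ofCategory E B)} (f : V ⟶ W)
    (c : ColTuple B) (i : Fin c.len) {y : B} (h : c.col i = y) (x : B) :
    V.coactUnaryObj c i h x ≫ Hom.app f y = Hom.app f x ▷ _ ≫ W.coactUnaryObj c i h x :=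
  Hom.comm_coactAt f c i h x

/-- The structure map in arity one of a coalgebra over an enriched category. -/
def coactUnary (V : OperadCoalgebra (EnrichedOperad.ofCategory E B)) (x y : B) :
    V.obj x ⊗ (y ⟶[E] x) ⟶ V.obj y :=
  V.obj x ◁ (unaryIso (single y) x rfl rfl).inv ≫ V.coactUnaryObj (single y) (0 : Fin 1) rfl x

/-- A tuple of length one is literally `single y`, so nothing but the identification `unaryIso`
intervenes. -/
lemma coactUnaryObj_eq (V : OperadCoalgebra (EnrichedOperad.ofCategory E B)) (c : ColTuple B)
    (hc : c.len = 1) (i : Fin c.len) {y : B} (h : c.col i = y) (x : B) :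
    V.coactUnaryObj c i h x =
      V.obj x ◁ (unaryIso c x hc (col_zero_eq hc h)).hom ≫ V.coactUnary x y := by
  obtain ⟨n, col⟩ := c
  obtain rfl : n = 1 := hc
  obtain rfl : i = (0 : Fin 1) := Subsingleton.elim (α := Fin 1) _ _
  obtain rfl : col = fun _ => y := funext fun j => by
    rw [← h, Subsingleton.elim (α := Fin 1) j 0]
  rw [coactUnary, ← whiskerLeft_comp_assoc, Iso.hom_inv_id, whiskerLeft_id, Category.id_comp]

lemma Hom.comm_coactUnary {V W : OperadCoalgebra (EnrichedOperad.ofCategory E B)} (f : V ⟶ W)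
    (x y : B) : V.coactUnary x y ≫ Hom.app f y = Hom.app f x ▷ _ ≫ W.coactUnary x y := by
  rw [coactUnary, coactUnary, Category.assoc, Hom.comm_coactUnaryObj, whisker_exchange_assoc]

lemma coactUnary_unit (V : OperadCoalgebra (EnrichedOperad.ofCategory E B)) (x : B) :
    (ρ_ (V.obj x)).inv ≫ V.obj x ◁ eId E x ≫ V.coactUnary x x = 𝟙 _ := by
  rw [coactUnary, ← whiskerLeft_comp_assoc, coactUnaryObj_unit]

/-- The inner axiom for two singleton tuples, freed of the isomorphisms `unaryIso`. The braiding
appears because `γ` takes the outer morphism first while `eComp` takes it last. -/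
lemma coactUnary_comp (V : OperadCoalgebra (EnrichedOperad.ofCategory E B)) (x y z : B) :
    V.obj x ◁ ((β_ _ _).hom ≫ eComp E z y x) ≫ V.coactUnary x z =
      (α_ _ _ _).inv ≫ V.coactUnary x y ▷ _ ≫ V.coactUnary y z := by
  have h := V.coactUnaryObj_inner (single y) (0 : Fin 1) rfl (single z) (0 : Fin 1) rfl x
  rw [V.coactUnaryObj_eq (single y) rfl, V.coactUnaryObj_eq (single z) rfl,
    V.coactUnaryObj_eq _ (insert_len_eq_one rfl rfl),
    unaryComp_eq (single y) (0 : Fin 1) (single z) rfl x rfl rfl rfl rfl,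
    ← whiskerLeft_comp_assoc] at h
  simp only [Category.assoc, Iso.inv_hom_id, Category.comp_id] at h
  rw [← cancel_epi (V.obj x ◁ ((unaryIso (single y) x rfl rfl).hom ⊗ₘ
    (unaryIso (single z) y rfl rfl).hom))]
  simp only [MonoidalCategory.whiskerLeft_comp, Category.assoc, comp_whiskerRight] at h ⊢
  refine h.trans ?_
  simp only [MonoidalCategory.tensorHom_def, MonoidalCategory.whiskerLeft_comp, Category.assoc,
    associator_inv_naturality_right_assoc, associator_inv_naturality_middle_assoc,
    whisker_exchange_assoc]

/-- Morphisms of coalgebras over an enriched category only have to be compatible with the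
structure maps in arity one. -/
def Hom.ofUnary {V W : OperadCoalgebra (EnrichedOperad.ofCategory E B)}
    (app : ∀ x, V.obj x ⟶ W.obj x)
    (comm : ∀ x y, V.coactUnary x y ≫ app y = app x ▷ _ ≫ W.coactUnary x y) : V ⟶ W :=
  Hom.ofComponents app fun c i x => by
    change V.coactUnaryObj c i rfl x ≫ _ = app x ▷ unaryObj c x ≫ W.coactUnaryObj c i rfl x
    by_cases hc : c.len = 1
    · rw [V.coactUnaryObj_eq c hc, W.coactUnaryObj_eq c hc, Category.assoc, comm,
        whisker_exchange_assoc]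
    · exact unaryObj_ext_right _ _ hc

/-- The transport maps `eqToHom` form a coalgebra morphism by `Hom.ofUnary`, and its compatibility
in all arities is the hypothesis of `ext_coactAt`. -/
lemma ext_coactUnary {V W : OperadCoalgebra (EnrichedOperad.ofCategory E B)} (h : V.obj = W.obj)
    (h' : ∀ x y, V.coactUnary x y ≫ eqToHom (congrFun h y) =
      eqToHom (congrFun h x) ▷ _ ≫ W.coactUnary x y) : V = W :=
  ext_coactAt h fun c i x =>
    Hom.comm_coactAt (Hom.ofUnary (fun x => eqToHom (congrFun h x)) h') c i rfl x

/-- Currying moves `X` to the target, leaving a source that is a product with an initial object,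
hence initial. -/
lemma unary_tensor_ext_left {c : ColTuple B} (x : B) {X W Z : E} (f g : X ⊗ (unaryObj c x ⊗ W) ⟶ Z)
    (h : c.len ≠ 1) : f = g :=
  curry_injective (unaryObj_ext_left _ _ h)

lemma unary_tensor_ext_right {c : ColTuple B} (x : B) {X W Z : E} (f g : X ⊗ (W ⊗ unaryObj c x) ⟶ Z)
    (h : c.len ≠ 1) : f = g :=
  curry_injective (unaryObj_ext_right _ _ h)

section OfUnary

variable (obj : B → E) (m : ∀ x y : B, obj x ⊗ (y ⟶[E] x) ⟶ obj y)

/-- The structure maps of the coalgebra associated with an action of an enriched category. -/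
def ofUnaryAux (c : ColTuple B) (i : Fin c.len) {y : B} (h : c.col i = y) (x : B) :
    obj x ⊗ unaryObj c x ⟶ obj y :=
  if hc : c.len = 1 then
    obj x ◁ (unaryIso c x hc (col_zero_eq hc h)).hom ≫ m x y
  else (IsInitial.ofIso (unaryInitial c x hc) (zeroMul (unaryInitial c x hc)).symm).to _

lemma ofUnaryAux_eq (c : ColTuple B) (hc : c.len = 1) (i : Fin c.len) {y : B} (h : c.col i = y)
    (x : B) : ofUnaryAux obj m c i h x =
      obj x ◁ (unaryIso c x hc (col_zero_eq hc h)).hom ≫ m x y :=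
  dif_pos hc

/-- The coalgebra associated with an action of an enriched category. -/
def ofUnary (unit : ∀ x, (ρ_ (obj x)).inv ≫ obj x ◁ eId E x ≫ m x x = 𝟙 _)
    (comp : ∀ x y z, obj x ◁ ((β_ _ _).hom ≫ eComp E z y x) ≫ m x z =
      (α_ _ _ _).inv ≫ m x y ▷ _ ≫ m y z) :
    OperadCoalgebra (EnrichedOperad.ofCategory E B) :=
  ofComponents (EnrichedOperad.ofCategory E B) obj (fun c i _ h x => ofUnaryAux obj m c i h x)
    (fun x => by
      change (ρ_ (obj x)).inv ≫ obj x ◁ (eId E x ≫ (unaryIso (single x) x rfl rfl).inv) ≫ _ = _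
      rw [ofUnaryAux_eq obj m (single x) rfl, ← whiskerLeft_comp_assoc, Category.assoc,
        Iso.inv_hom_id, Category.comp_id, unit])
    (fun {d c} f i y h x => by
      change obj x ◁ eqToHom (unaryObj_hom f x) ≫ _ = _
      have hl : d.len = c.len := by simpa using Fintype.card_congr f.equiv
      by_cases hc : c.len = 1
      · rw [ofUnaryAux_eq obj m c hc, ofUnaryAux_eq obj m d (hl.trans hc), ← whiskerLeft_comp_assoc]
        simp [unaryIso]
      · exact unaryObj_ext_right _ _ hc)
    (fun c i y h k hik c' d hk x => by
      -- Two distinct positions exclude arity one, so the outer axiom compares maps out of an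
      -- initial object.
      have hc : c.len ≠ 1 := fun e => hik (by ext; omega)
      exact unary_tensor_ext_left x _ _ hc)
    (fun c i d h c' j y h' x => by
      by_cases hc : c.len = 1
      · by_cases hc' : c'.len = 1
        · change obj x ◁ unaryComp c i c' h x ≫ _ = (α_ _ _ _).inv ≫
            ofUnaryAux obj m c i h x ▷ unaryObj c' d ≫ ofUnaryAux obj m c' j h' d
          rw [unaryComp_eq c i c' h x hc hc' (col_zero_eq hc' h')
            (col_zero_eq hc h), ofUnaryAux_eq obj m c hc, ofUnaryAux_eq obj m c' hc',
            ofUnaryAux_eq obj m _ (insert_len_eq_one hc hc'), ← whiskerLeft_comp_assoc]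
          have := comp x d y
          simp only [Category.assoc, Iso.inv_hom_id, Category.comp_id]
          rw [MonoidalCategory.whiskerLeft_comp, Category.assoc, this]
          simp only [MonoidalCategory.tensorHom_def, MonoidalCategory.whiskerLeft_comp,
            Category.assoc, associator_inv_naturality_right_assoc,
            associator_inv_naturality_middle_assoc, whisker_exchange_assoc, comp_whiskerRight]
        · exact unary_tensor_ext_right d _ _ hc'
      · exact unary_tensor_ext_left x _ _ hc)

lemma ofUnary_coactUnary (unit comp) (x y : B) :
    (ofUnary obj m unit comp).coactUnary x y = m x y := by
  have : (ofUnary obj m unit comp).coactUnaryObj (single y) (0 : Fin 1) rfl x =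
      ofUnaryAux obj m (single y) (0 : Fin 1) rfl x := ofComponents_coactAt _ _ _ _ _ _ _ _ _ _ _
  rw [coactUnary, this, ofUnaryAux_eq obj m (single y) rfl]
  refine (whiskerLeft_comp_assoc _ _ _ _).symm.trans ?_
  rw [Iso.inv_hom_id, whiskerLeft_id]
  exact Category.id_comp _

end OfUnary

variable {A : Type w'} [EnrichedCategory E A]

/-- The action of an enriched category on a coalgebra over its opposite. -/
def coactOp (V : OperadCoalgebra (EnrichedOperad.ofCategory E Aᵒᵖ)) (x y : A) :
    V.obj (op x) ⊗ (x ⟶[E] y) ⟶ V.obj (op y) :=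
  V.coactUnary (op x) (op y)

lemma coactOp_unit (V : OperadCoalgebra (EnrichedOperad.ofCategory E Aᵒᵖ)) (x : A) :
    (ρ_ (V.obj (op x))).inv ≫ V.obj (op x) ◁ eId E x ≫ V.coactOp x x = 𝟙 _ :=
  V.coactUnary_unit (op x)

/-- Passing to the opposite category cancels the reversal in `coactUnary_comp`, which leaves a
covariant action. -/
lemma coactOp_comp (V : OperadCoalgebra (EnrichedOperad.ofCategory E Aᵒᵖ)) (x y z : A) :
    V.obj (op x) ◁ eComp E x y z ≫ V.coactOp x z =
      (α_ _ _ _).inv ≫ V.coactOp x y ▷ _ ≫ V.coactOp y z := by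
  rw [eComp_eq_braiding_eComp_op]
  exact V.coactUnary_comp (op x) (op y) (op z)

/-- The enriched functor associated with a coalgebra over the opposite of an enriched category. -/
@[simps]
def opEnrichedFunctor (V : OperadCoalgebra (EnrichedOperad.ofCategory E Aᵒᵖ)) :
    EnrichedFunctor E A E where
  obj x := V.obj (op x)
  map x y := curry (V.coactOp x y)
  map_id x := by
    refine (curry_natural_left _ _).symm.trans (congrArg curry ?_)
    exact ((Iso.inv_comp_eq _).1 (V.coactOp_unit x)).trans (Category.comp_id _)
  map_comp x y z := (curry_natural_left _ _).symm.trans <|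
    (congrArg curry (V.coactOp_comp x y z)).trans (curry_tensorHom_curry_eComp _ _).symm

lemma opEnrichedFunctor_naturality_iff {V W : OperadCoalgebra (EnrichedOperad.ofCategory E Aᵒᵖ)}
    (x y : A) (f : V.obj (op x) ⟶ W.obj (op x)) (g : V.obj (op y) ⟶ W.obj (op y)) :
    V.opEnrichedFunctor.map x y ≫ (ihom (V.obj (op x))).map g =
        W.opEnrichedFunctor.map x y ≫ (pre f).app (W.obj (op y)) ↔
      V.coactOp x y ≫ g = f ▷ _ ≫ W.coactOp x y := by
  refine (comp_ihom_map_eq_comp_pre_iff _ _ _ _).trans ?_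
  rw [opEnrichedFunctor_map, opEnrichedFunctor_map]
  exact Eq.congr (congrArg (· ≫ g) (uncurry_curry _)) (congrArg (f ▷ _ ≫ ·) (uncurry_curry _))

variable (E A) in
/-- The functor from coalgebras over the opposite of an enriched category to algebras. -/
def opToCatAlgebra : OperadCoalgebra (EnrichedOperad.ofCategory E Aᵒᵖ) ⥤ CatAlgebra E A where
  obj V := ⟨V.opEnrichedFunctor⟩
  map {V W} f := ⟨fun x => Hom.app f (op x), fun x y =>
    (opEnrichedFunctor_naturality_iff x y _ _).2 (Hom.comm_coactUnary f (op x) (op y))⟩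

/-- The coalgebra associated with an enriched functor. -/
def ofOpEnrichedFunctor (F : EnrichedFunctor E A E) :
    OperadCoalgebra (EnrichedOperad.ofCategory E Aᵒᵖ) :=
  ofUnary (fun x => F.obj x.unop) (fun x y => uncurry (F.map x.unop y.unop))
    (fun x => by
      have : F.obj x.unop ◁ eId E x.unop ≫ uncurry (F.map x.unop x.unop) = (ρ_ _).hom := by
        rw [← uncurry_natural_left, F.map_id, eId_eq_curry, uncurry_curry]
      exact (congrArg ((ρ_ _).inv ≫ ·) this).trans (Iso.inv_hom_id _))
    (fun x y z => by
      have e : (β_ (y ⟶[E] x) (z ⟶[E] y)).hom ≫ eComp E z y x =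
        eComp E x.unop y.unop z.unop := (eComp_eq_braiding_eComp_op x.unop y.unop z.unop).symm
      rw [e]
      refine curry_injective <| (curry_natural_left _ _).trans <|
        (congrArg (_ ≫ ·) (curry_uncurry _)).trans <| (F.map_comp _ _ _).trans <|
        Eq.trans ?_ (curry_tensorHom_curry_eComp _ _)
      rw [curry_uncurry, curry_uncurry])

/-- Currying the unary structure maps is invertible, and neither coalgebras nor their morphisms
carry further data in the other arities. -/
instance : (opToCatAlgebra E A).IsIso where
  faithful := ⟨fun {V W f g} h => Hom.ext <| funext fun x =>
    congrFun (congrArg CatAlgebra.Hom.app h) x.unop⟩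
  full := ⟨fun {V W} f => ⟨Hom.ofUnary (fun x => CatAlgebra.Hom.app f x.unop) fun x y =>
    (opEnrichedFunctor_naturality_iff x.unop y.unop _ _).1
      (CatAlgebra.Hom.naturality f x.unop y.unop), rfl⟩⟩
  bijective_obj := by
    refine ⟨fun V W h => ?_, fun F => ⟨ofOpEnrichedFunctor F.toFunctor, ?_⟩⟩
    · have h : V.opEnrichedFunctor = W.opEnrichedFunctor := congrArg CatAlgebra.toFunctor h
      refine ext_coactUnary (funext fun x => congrFun (congrArg EnrichedFunctor.obj h) x.unop)
        fun x y => ?_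
      have := uncurry_enrichedFunctor_map_eqToHom h x.unop y.unop (𝟙 _)
      rw [Category.id_comp, Category.id_comp, opEnrichedFunctor_map, opEnrichedFunctor_map] at this
      exact ((congrArg (· ≫ _) (uncurry_curry _).symm).trans this).trans
        (congrArg (_ ≫ ·) (uncurry_curry _))
    · obtain ⟨F⟩ := F
      refine congrArg CatAlgebra.mk (EnrichedFunctor.ext E (fun _ => rfl) fun x y => ?_)
      exact (Category.comp_id _).trans <|
        (congrArg curry (ofUnary_coactUnary _ _ _ _ (op x) (op y))).trans (curry_uncurry _)

end OperadCoalgebra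

end Unary

lemma OperadCoalgebra.ofFunctor_opEnrichedFunctor {E : Type u} [Category.{v} E]
    [CartesianMonoidalCategory E] [BraidedCategory E] [MonoidalClosed E] [HasColimits E]
    {A : Type w'} [EnrichedCategory E A]
    (V : OperadCoalgebra (EnrichedOperad.ofCategory E Aᵒᵖ)) :
    GraphHom.ofFunctor V.opEnrichedFunctor = V.opAction := by
  refine GraphHom.ext rfl (heq_of_eq (funext₂ fun x y => congrArg curry ?_))
  exact congrArg (fun f => V.obj (op x) ◁ (unaryIso (single (op y)) (op x) rfl rfl).inv ≫ f)
    (V.coact_π (single (op y)) (0 : Fin 1) (op x)).symm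

end ColouredOperad

end

/-! ### Assembly of the isomorphisms of categories. -/

theorem mainTheorem11 {E : Type u} [Category.{v} E] [CartesianMonoidalCategory E]
    [BraidedCategory E] [MonoidalClosed E] [HasColimits E] {C : Type v}
    (P : EnrichedOperad E C) :
    ∃ (_ : EnrichedCategory E C) (ι : ∀ x y : C, generators P x y ⟶ (x ⟶[E] y)),
      IsCartPresentation.{w} ι ∧
      ∃ (Φ : IsoCat (OperadCoalgebra P) (OperadCoalgebra (EnrichedOperad.ofCategory E Cᵒᵖ)))
        (Ψ : IsoCat (OperadCoalgebra (EnrichedOperad.ofCategory E Cᵒᵖ)) (CatAlgebra E C)),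
        Φ.functor ⋙ OperadCoalgebra.forget (EnrichedOperad.ofCategory E Cᵒᵖ) ⋙
            Pi.comap (fun _ => E) Opposite.op = OperadCoalgebra.forget P ∧
        Ψ.functor ⋙ CatAlgebra.forget E C =
          OperadCoalgebra.forget (EnrichedOperad.ofCategory E Cᵒᵖ) ⋙
            Pi.comap (fun _ => E) Opposite.op ∧
        (∀ V : OperadCoalgebra (EnrichedOperad.ofCategory E Cᵒᵖ),
          GraphHom.ofFunctor (Ψ.functor.obj V).toFunctor = V.opAction) ∧
        (∀ V : OperadCoalgebra P,
          ((GraphHom.ofId ι).comp (Ψ.functor.obj (Φ.functor.obj V)).toFunctor).precomp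
            (generatorsπ P) = V.rawAction) := by
  let inst := generatorsCategory P
  let ι : ∀ x y : C, generators P x y ⟶ (x ⟶[E] y) := fun x y => 𝟙 (generators P x y)
  have hι : SatisfiesRelations (GraphHom.ofId ι) := satisfiesRelations_generatorsCategory P
  have : ∀ x y, IsIso (ι x y) := fun x y => inferInstanceAs (IsIso (𝟙 (generators P x y)))
  let Θ := OperadCoalgebra.toCatAlgebra hι
  let Ψ := (OperadCoalgebra.opToCatAlgebra E C).asIsomorphism
  -- With `Φ` defined through the inverse of `Ψ`, the composite `Φ.functor ⋙ Ψ.functor` is strictly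
  -- `Θ`, whose action on generators is known.
  let Φ := Θ.asIsomorphism.trans Ψ.symm
  have hΨ : Ψ.functor ⋙ CatAlgebra.forget E C =
      OperadCoalgebra.forget (EnrichedOperad.ofCategory E Cᵒᵖ) ⋙
        Pi.comap (fun _ => E) Opposite.op := rfl
  have hΘ : Φ.functor ⋙ Ψ.functor = Θ :=
    congrArg (Θ ⋙ ·) Ψ.counit_eq
  refine ⟨inst, ι, isCartPresentation hι, Φ, Ψ, ?_, hΨ,
    OperadCoalgebra.ofFunctor_opEnrichedFunctor, fun V => ?_⟩
  -- By `hΨ`, which holds definitionally, forgetting after `Φ` is forgetting after `Φ.functor ⋙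
  -- Ψ.functor`, that is, after `Θ`.
  · exact congrArg (· ⋙ CatAlgebra.forget E C) hΘ
  · have hV : Ψ.functor.obj (Φ.functor.obj V) = Θ.obj V := Functor.congr_obj hΘ V
    rw [hV]
    refine GraphHom.ext rfl (heq_of_eq (funext₂ fun x y => ?_))
    exact (congrArg _ (V.ι_toEnrichedFunctor_map hι x y)).trans (V.generatorsπ_actionMap x y)
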